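/- Let $\mathcal B$ be a unital C$^*$-algebra. A $\mathcal B$-valued C$^*$-probability space $(\mathcal A,E)$ consists of a unital inclusion $\mathcal B\subset\mathcal A$ of C$^*$-algebras and a positive conditional expectation $E:\mathcal A\to\mathcal B$. Let $\mathcal B\langle\mathcal X\rangle$ be the $*$-algebra freely generated by $\mathcal B$ and a self-adjoint symbol $\mathcal X$, and $\mathcal B\langle\mathcal X\rangle_0$ the polynomials without free term; the distribution of $X=X^*\in\mathcal A$ is the map $\mu_X:\mathcal B\langle\mathcal X\rangle\to\mathcal B$, $\mu_X(p)=E(p(X))$, and $\mathcal B\langle X\rangle_0=\{p(X):p\in\mathcal B\langle\mathcal X\rangle_0\}$. A family $(X_i)_{i\in I}$ of self-adjoint elements, $I$ totally ordered, is monotone independent over $\mathcal B$ if $$E(A_1\cdots A_{j-1}A_jA_{j+1}\cdots A_n)=E(A_1\cdots A_{j-1}\,E(A_j)\,A_{j+1}\cdots A_n)$$ whenever $A_l\in\mathcal B\langle X_{\epsilon(l)}\rangle_0$, $\epsilon(l)\ne\epsilon(l+1)$, and $\epsilon(j-1)<\epsilon(j)>\epsilon(j+1)$ (a condition on a neighbour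 that does not exist is void). For $n\ge1$ let $NC_2(n)$ be the set of non-crossing partitions of $\{1,\dots,n\}$ all of whose blocks have exactly two elements (empty for odd $n$), and let $|\gamma|$ be the number of blocks of $\gamma$. For $\gamma\in NC_2(n)$ let $\widetilde\gamma\in NC_2(n+2)$ be the partition consisting of the block $\{1,n+2\}$ and the blocks of $\gamma$ shifted by $1$; for $\gamma_1\in NC_2(n)$, $\gamma_2\in NC_2(m)$ let $\gamma_1\oplus\gamma_2\in NC_2(n+m)$ be their juxtaposition in this order. Theorem. Let $(X_i)_{i\ge1}$ be a sequence of centered ($E(X_i)=0$), identically distributed ($\mu_{X_i}=\mu_{X_j}$ for all $i,j$), monotone independent self-adjoint elements of a $\mathcal B$-valued C$^*$-probability space $(\mathcal A,E)$, with common variance $\eta:\mathcal B\to\mathcal B$, $\eta(b)=E(X_ibX_i)$. Then there is a positive conditional expectation $\mathfrak a:\mathcal B\langle\mathcal X\rangle\to\mathcal B$, depending only on $\eta$ (and not on $\mathcal A$, $E$ or the $X_i$ otherwise), such that the distributions $\sigma_N$ of $S_N=N^{-1/2}(X_1+\dots+X_N)$ converge weakly to $\mathfrak a$, i.e. $\sigma_N(p)\to\mathfrak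 a(p)$ in norm for every $p\in\mathcal B\langle\mathcal X\rangle$. Moreover, for each $m$ there are maps $b\mapsto V(\gamma,b)$ from $M_m(\mathcal B)$ to itself, one for each $\gamma\in NC_2(n)$, $n\ge1$, which are uniquely determined by the recurrences 1. $V(\{(1,2)\},b)=\eta_m(b)$; 2. $V(\gamma_1\oplus\gamma_2,b)=V(\gamma_1,b)\cdot b\cdot V(\gamma_2,b)$; 3. $V(\widetilde\gamma,b)=\frac1{|\gamma|+1}\,\eta_m\bigl(b\cdot V(\gamma,b)\cdot b\bigr)$, where $\eta_m=\eta\otimes 1_m$ is $\eta$ applied entrywise, and with them the fully matricial extension $\widetilde{\mathfrak a}=(\mathfrak a\otimes1_m)_m$ satisfies, for all $m,n\ge1$ and $b\in M_m(\mathcal B)$, $$\widetilde{\mathfrak a}\bigl([\mathcal X b]^n\bigr)=\sum_{\gamma\in NC_2(n)}V(\gamma,b)\cdot b .$$ -/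

import Mathlib

open Filter Topology

noncomputable section

/-! ### The `*`-algebra `B⟨𝒳⟩` freely generated by `B` and a self-adjoint symbol `𝒳` -/

/-- Relations presenting `B⟨𝒳⟩`: the generator `some b` stands for `b ∈ B`, the generator `none`
for the symbol `𝒳`. -/
inductive NCPolyRel (B : Type*) [Ring B] [Algebra ℂ B] :
    FreeAlgebra ℂ (Option B) → FreeAlgebra ℂ (Option B) → Prop
  | add (b c : B) : NCPolyRel B (FreeAlgebra.ι ℂ (some (b + c)))
      (FreeAlgebra.ι ℂ (some b) + FreeAlgebra.ι ℂ (some c))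
  | mul (b c : B) : NCPolyRel B (FreeAlgebra.ι ℂ (some (b * c)))
      (FreeAlgebra.ι ℂ (some b) * FreeAlgebra.ι ℂ (some c))
  | scalar (z : ℂ) : NCPolyRel B (FreeAlgebra.ι ℂ (some (algebraMap ℂ B z)))
      (algebraMap ℂ (FreeAlgebra ℂ (Option B)) z)

/-- `B⟨𝒳⟩`: noncommutative polynomials in `𝒳` with coefficients in `B`. -/
abbrev NCPoly (B : Type*) [Ring B] [Algebra ℂ B] : Type _ := RingQuot (NCPolyRel B)

namespace NCPoly

/-- The embedding of the coefficient algebra `B` into `B⟨𝒳⟩`. -/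
def coeff (B : Type*) [Ring B] [Algebra ℂ B] : B →ₐ[ℂ] NCPoly B :=
  AlgHom.ofLinearMap
    { toFun := fun b => RingQuot.mkAlgHom ℂ (NCPolyRel B) (FreeAlgebra.ι ℂ (some b))
      map_add' := fun b c => by
        rw [RingQuot.mkAlgHom_rel ℂ (NCPolyRel.add b c), map_add]
      map_smul' := fun z b => by
        rw [Algebra.smul_def, RingQuot.mkAlgHom_rel ℂ (NCPolyRel.mul (algebraMap ℂ B z) b), map_mul,
          RingQuot.mkAlgHom_rel ℂ (NCPolyRel.scalar (B := B) z), AlgHom.commutes,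
          RingHom.id_apply, Algebra.smul_def] }
    (by
      have h := RingQuot.mkAlgHom_rel ℂ (NCPolyRel.scalar (B := B) 1)
      simpa using h)
    (fun b c => by
      change RingQuot.mkAlgHom ℂ (NCPolyRel B) _ = _
      rw [RingQuot.mkAlgHom_rel ℂ (NCPolyRel.mul b c), map_mul]
      rfl)

/-- The symbol `𝒳` of `B⟨𝒳⟩`. -/
def X (B : Type*) [Ring B] [Algebra ℂ B] : NCPoly B :=
  RingQuot.mkAlgHom ℂ (NCPolyRel B) (FreeAlgebra.ι ℂ none)

section lift

variable {B : Type*} [Ring B] [Algebra ℂ B] {A : Type*} [Ring A] [Algebra ℂ A]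

/-- Universal property of `B⟨𝒳⟩`: evaluation `p(𝒳) ↦ p(a)`, where the coefficients are sent to `A`
by `ι`. -/
def eval (ι : B →ₐ[ℂ] A) (a : A) : NCPoly B →ₐ[ℂ] A :=
  RingQuot.liftAlgHom ℂ
    ⟨FreeAlgebra.lift ℂ (fun o : Option B => o.elim a ι), by
      intro p q h
      cases h <;> simp⟩

theorem eval_coeff (ι : B →ₐ[ℂ] A) (a : A) (b : B) : eval ι a (coeff B b) = ι b := by
  change eval ι a (RingQuot.mkAlgHom ℂ (NCPolyRel B) (FreeAlgebra.ι ℂ (some b))) = ι b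
  simp [eval, RingQuot.liftAlgHom_mkAlgHom_apply]

theorem eval_X (ι : B →ₐ[ℂ] A) (a : A) : eval ι a (X B) = a := by
  simp [eval, X, RingQuot.liftAlgHom_mkAlgHom_apply]

theorem induction {P : NCPoly B → Prop} (hC : ∀ b, P (coeff B b)) (hX : P (X B))
    (hadd : ∀ p q, P p → P q → P (p + q)) (hmul : ∀ p q, P p → P q → P (p * q))
    (p : NCPoly B) : P p := by
  obtain ⟨x, rfl⟩ := RingQuot.mkAlgHom_surjective ℂ (NCPolyRel B) p
  induction x using FreeAlgebra.induction with
  | grade0 z =>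
    rw [AlgHom.commutes, ← (coeff B).commutes]
    exact hC _
  | grade1 o =>
    cases o with
    | none => exact hX
    | some b => exact hC b
  | mul a b ha hb => rw [map_mul]; exact hmul _ _ ha hb
  | add a b ha hb => rw [map_add]; exact hadd _ _ ha hb

end lift

/-! The involution of `B⟨𝒳⟩`: the conjugate-linear anti-automorphism with `𝒳* = 𝒳` that extends
the involution of `B`. -/

/-- The opposite algebra of `B⟨𝒳⟩` with conjugated scalar multiplication, an auxiliary target in the
construction of the involution. -/
def ConjOp (B : Type*) [Ring B] [Algebra ℂ B] : Type _ := (NCPoly B)ᵐᵒᵖ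

instance (B : Type*) [Ring B] [Algebra ℂ B] : Ring (ConjOp B) :=
  inferInstanceAs (Ring (NCPoly B)ᵐᵒᵖ)

instance (B : Type*) [Ring B] [Algebra ℂ B] : Algebra ℂ (ConjOp B) :=
  RingHom.toAlgebra' ((algebraMap ℂ (NCPoly B)ᵐᵒᵖ).comp (starRingEnd ℂ))
    (fun z x => Algebra.commutes (A := (NCPoly B)ᵐᵒᵖ) (starRingEnd ℂ z) x)

section star

variable (B : Type*) [Ring B] [StarRing B] [Algebra ℂ B] [StarModule ℂ B]

/-- The coefficient embedding composed with the involution of `B`. -/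
def coeffStar : B →ₐ[ℂ] ConjOp B where
  toFun b := (MulOpposite.op (coeff B (star b)) : (NCPoly B)ᵐᵒᵖ)
  map_one' := by rw [star_one, map_one]; rfl
  map_mul' b c := by rw [star_mul, map_mul]; rfl
  map_zero' := by rw [star_zero, map_zero]; rfl
  map_add' b c := by rw [star_add, map_add]; rfl
  commutes' z := by
    rw [← algebraMap_star_comm, AlgHom.commutes]
    rfl

/-- The involution of `B⟨𝒳⟩` as a homomorphism into the conjugate opposite algebra. -/
def starHom : NCPoly B →ₐ[ℂ] ConjOp B :=
  eval (coeffStar B) (MulOpposite.op (X B) : (NCPoly B)ᵐᵒᵖ)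

instance : Star (NCPoly B) where
  star p := MulOpposite.unop (starHom B p : (NCPoly B)ᵐᵒᵖ)

theorem star_coeff (b : B) : star (coeff B b) = coeff B (star b) :=
  congrArg (fun q : (NCPoly B)ᵐᵒᵖ => q.unop) (eval_coeff (coeffStar B) _ b)

theorem star_X : star (X B) = X B :=
  congrArg (fun q : (NCPoly B)ᵐᵒᵖ => q.unop) (eval_X (coeffStar B) _)

theorem star_add_aux (p q : NCPoly B) : star (p + q) = star p + star q :=
  congrArg (fun q : (NCPoly B)ᵐᵒᵖ => q.unop) (map_add (starHom B) p q)

theorem star_mul_aux (p q : NCPoly B) : star (p * q) = star q * star p :=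
  congrArg (fun q : (NCPoly B)ᵐᵒᵖ => q.unop) (map_mul (starHom B) p q)

instance : StarRing (NCPoly B) where
  star_involutive p := by
    induction p using NCPoly.induction with
    | hC b => rw [star_coeff, star_coeff, star_star]
    | hX => rw [star_X, star_X]
    | hadd p q hp hq => rw [star_add_aux, star_add_aux, hp, hq]
    | hmul p q hp hq => rw [star_mul_aux, star_mul_aux, hp, hq]
  star_add := star_add_aux B
  star_mul := star_mul_aux B

/-- The embedding of `B` into `B⟨𝒳⟩` as a `*`-homomorphism. -/
def C : B →⋆ₐ[ℂ] NCPoly B :=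
  { coeff B with map_star' := fun b => (star_coeff B b).symm }

end star

/-- `B⟨𝒳⟩₀`: the polynomials without free term, i.e. those that vanish at `𝒳 = 0`. -/
def noFreeTerm (B : Type*) [Ring B] [Algebra ℂ B] : Set (NCPoly B) :=
  {p | eval (AlgHom.id ℂ B) 0 p = 0}

end NCPoly

/-! ### `B`-valued probability -/

/-- `E` is a positive conditional expectation from the `*`-algebra `A` onto its `*`-subalgebra `B`,
the inclusion being `ι`. -/
structure IsPosCondExp {B A : Type*} [CStarAlgebra B] [PartialOrder B]
    [Ring A] [StarRing A] [Algebra ℂ A] (ι : B →⋆ₐ[ℂ] A) (E : A →ₗ[ℂ] B) : Prop where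
  map_incl : ∀ b : B, E (ι b) = b
  map_bimodule : ∀ (b c : B) (a : A), E (ι b * a * ι c) = b * E a * c
  nonneg : ∀ a : A, 0 ≤ E (star a * a)

section prob

variable {B A : Type*} [CStarAlgebra B] [CStarAlgebra A]

/-- The distribution `μ_a : B⟨𝒳⟩ → B`, `μ_a(p(𝒳)) = E(p(a))`. -/
def distribution (ι : B →⋆ₐ[ℂ] A) (E : A →ₗ[ℂ] B) (a : A) : NCPoly B →ₗ[ℂ] B :=
  E ∘ₗ (NCPoly.eval ι.toAlgHom a).toLinearMap

/-- `B⟨a⟩₀ ⊆ A`: the values at `a` of the polynomials without free term. -/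
def polyValues₀ (ι : B →⋆ₐ[ℂ] A) (a : A) : Set A :=
  NCPoly.eval ι.toAlgHom a '' NCPoly.noFreeTerm B

/-- Monotone independence over `B` of a family `X` indexed by a totally ordered set: in an
expectation of a product `A₁ ⋯ Aₙ`, with `A_l ∈ B⟨X_{ε(l)}⟩₀` and consecutive indices distinct, a
factor `A_j` whose index is larger than those of its (existing) neighbours may be replaced by
`E(A_j)`. The product is written as `l₁`, then the factor `A_j = x` with index `i`, then `l₂`, each
factor being paired with its index. -/
def MonotoneIndependent {I : Type*} [LinearOrder I] (ι : B →⋆ₐ[ℂ] A) (E : A →ₗ[ℂ] B)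
    (X : I → A) : Prop :=
  ∀ (l₁ l₂ : List (I × A)) (i : I) (x : A),
    (∀ y ∈ l₁ ++ (i, x) :: l₂, y.2 ∈ polyValues₀ ι (X y.1)) →
    (l₁ ++ (i, x) :: l₂).IsChain (fun y z => y.1 ≠ z.1) →
    (∀ y ∈ l₁.getLast?, y.1 < i) →
    (∀ y ∈ l₂.head?, y.1 < i) →
    E ((l₁.map Prod.snd).prod * x * (l₂.map Prod.snd).prod) =
      E ((l₁.map Prod.snd).prod * ι (E x) * (l₂.map Prod.snd).prod)

/-- The normalized sum `S_N` of the first `N` variables. -/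
def normalizedSum (X : ℕ → A) (N : ℕ) : A :=
  ((1 / Real.sqrt N : ℝ) : ℂ) • ∑ i ∈ Finset.range N, X i

end prob

/-- The element `𝒳 · b` of `M_m(B⟨𝒳⟩)`, for `b ∈ M_m(B)`. -/
def matX {B : Type*} [CStarAlgebra B] {m : ℕ} (b : Matrix (Fin m) (Fin m) B) :
    Matrix (Fin m) (Fin m) (NCPoly B) :=
  Matrix.scalar (Fin m) (NCPoly.X B) * b.map (NCPoly.C B)

/-! ### Non-crossing pair partitions -/

/-- A partition of `{1, …, n}` is non-crossing if no two distinct blocks `P`, `Q` contain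
`i, k ∈ P` and `j, l ∈ Q` with `i < j < k < l`. -/
def IsNonCrossing {n : ℕ} (π : Finpartition (Finset.Icc 1 n)) : Prop :=
  ∀ P ∈ π.parts, ∀ Q ∈ π.parts, P ≠ Q →
    ¬ ∃ i j k l : ℕ, i < j ∧ j < k ∧ k < l ∧ i ∈ P ∧ k ∈ P ∧ j ∈ Q ∧ l ∈ Q

/-- `NC₂(n)`: the non-crossing partitions of `{1, …, n}` all of whose blocks have two elements. -/
def NC2 (n : ℕ) : Type :=
  {π : Finpartition (Finset.Icc 1 n) // IsNonCrossing π ∧ ∀ P ∈ π.parts, P.card = 2}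

namespace NC2

open Classical in
instance (n : ℕ) : Fintype (NC2 n) :=
  inferInstanceAs (Fintype {π : Finpartition (Finset.Icc 1 n) //
    IsNonCrossing π ∧ ∀ P ∈ π.parts, P.card = 2})

/-- The set of blocks. -/
def blocks {n : ℕ} (γ : NC2 n) : Finset (Finset ℕ) := γ.1.parts

/-- `|γ|`, the number of blocks. -/
def numBlocks {n : ℕ} (γ : NC2 n) : ℕ := γ.blocks.card

/-- Build an element of `NC₂(n)` from its set of blocks. -/
def ofBlocks {n : ℕ} (parts : Finset (Finset ℕ)) (hsub : ∀ P ∈ parts, P ⊆ Finset.Icc 1 n)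
    (hcover : ∀ a ∈ Finset.Icc 1 n, ∃ P ∈ parts, a ∈ P)
    (hdisj : ∀ P ∈ parts, ∀ Q ∈ parts, ∀ a, a ∈ P → a ∈ Q → P = Q)
    (hcard : ∀ P ∈ parts, P.card = 2)
    (hnc : ∀ P ∈ parts, ∀ Q ∈ parts, P ≠ Q →
      ¬ ∃ i j k l : ℕ, i < j ∧ j < k ∧ k < l ∧ i ∈ P ∧ k ∈ P ∧ j ∈ Q ∧ l ∈ Q) : NC2 n :=
  ⟨Finpartition.ofExistsUnique parts hsub
    (fun a ha => by
      obtain ⟨P, hP, haP⟩ := hcover a ha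
      exact ⟨P, ⟨hP, haP⟩, fun Q hQ => hdisj Q hQ.1 P hP a hQ.2 haP⟩)
    (fun h => by simpa using hcard ∅ h), hnc, hcard⟩

/-- The translate by `s` of a set of blocks. -/
def shift (s : ℕ) (F : Finset (Finset ℕ)) : Finset (Finset ℕ) :=
  F.image (fun P => P.image (· + s))

theorem blocks_subset {n : ℕ} (γ : NC2 n) {P : Finset ℕ} (hP : P ∈ γ.blocks) :
    P ⊆ Finset.Icc 1 n := γ.1.le hP

theorem blocks_cover {n : ℕ} (γ : NC2 n) {a : ℕ} (ha : a ∈ Finset.Icc 1 n) :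
    ∃ P ∈ γ.blocks, a ∈ P := γ.1.exists_mem ha

theorem blocks_disj {n : ℕ} (γ : NC2 n) {P Q : Finset ℕ} (hP : P ∈ γ.blocks) (hQ : Q ∈ γ.blocks)
    {a : ℕ} (haP : a ∈ P) (haQ : a ∈ Q) : P = Q := γ.1.eq_of_mem_parts hP hQ haP haQ

/-- The partition `(1,2)`, the only element of `NC₂(2)`. -/
def pair : NC2 2 :=
  ofBlocks {{1, 2}} (by decide) (by decide) (by simp) (by simp) (by simp)

theorem mem_image_add {s a : ℕ} {P : Finset ℕ} :
    a ∈ P.image (· + s) ↔ ∃ c ∈ P, c + s = a := Finset.mem_image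

theorem mem_shift {s : ℕ} {F : Finset (Finset ℕ)} {P : Finset ℕ} :
    P ∈ shift s F ↔ ∃ Q ∈ F, Q.image (· + s) = P := Finset.mem_image

theorem blocks_card {n : ℕ} (γ : NC2 n) {P : Finset ℕ} (hP : P ∈ γ.blocks) : P.card = 2 :=
  γ.2.2 P hP

theorem shift_card {n s : ℕ} (γ : NC2 n) {P : Finset ℕ} (hP : P ∈ shift s γ.blocks) :
    P.card = 2 := by
  obtain ⟨Q, hQ, rfl⟩ := mem_shift.1 hP
  rw [Finset.card_image_of_injective _ (add_left_injective s), γ.blocks_card hQ]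

theorem shift_range {n s : ℕ} (γ : NC2 n) {P : Finset ℕ} (hP : P ∈ shift s γ.blocks) {a : ℕ}
    (ha : a ∈ P) : s + 1 ≤ a ∧ a ≤ n + s := by
  obtain ⟨Q, hQ, rfl⟩ := mem_shift.1 hP
  obtain ⟨c, hc, rfl⟩ := mem_image_add.1 ha
  have := Finset.mem_Icc.1 (γ.blocks_subset hQ hc)
  omega

theorem shift_cover {n s : ℕ} (γ : NC2 n) {a : ℕ} (h₁ : s + 1 ≤ a) (h₂ : a ≤ n + s) :
    ∃ P ∈ shift s γ.blocks, a ∈ P := by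
  obtain ⟨P, hP, haP⟩ := γ.blocks_cover (a := a - s) (Finset.mem_Icc.2 (by omega))
  exact ⟨_, mem_shift.2 ⟨P, hP, rfl⟩, mem_image_add.2 ⟨a - s, haP, by omega⟩⟩

theorem shift_disj {n s : ℕ} (γ : NC2 n) {P Q : Finset ℕ} (hP : P ∈ shift s γ.blocks)
    (hQ : Q ∈ shift s γ.blocks) {a : ℕ} (haP : a ∈ P) (haQ : a ∈ Q) : P = Q := by
  obtain ⟨P', hP', rfl⟩ := mem_shift.1 hP
  obtain ⟨Q', hQ', rfl⟩ := mem_shift.1 hQ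
  obtain ⟨c, hc, rfl⟩ := mem_image_add.1 haP
  obtain ⟨d, hd, hdc⟩ := mem_image_add.1 haQ
  obtain rfl : d = c := by omega
  rw [γ.blocks_disj hP' hQ' hc hd]

theorem shift_nonCrossing {n s : ℕ} (γ : NC2 n) {P Q : Finset ℕ} (hP : P ∈ shift s γ.blocks)
    (hQ : Q ∈ shift s γ.blocks) (hPQ : P ≠ Q) :
    ¬ ∃ i j k l : ℕ, i < j ∧ j < k ∧ k < l ∧ i ∈ P ∧ k ∈ P ∧ j ∈ Q ∧ l ∈ Q := by
  rintro ⟨i, j, k, l, hij, hjk, hkl, hi, hk, hj, hl⟩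
  obtain ⟨P', hP', rfl⟩ := mem_shift.1 hP
  obtain ⟨Q', hQ', rfl⟩ := mem_shift.1 hQ
  obtain ⟨i', hi', rfl⟩ := mem_image_add.1 hi
  obtain ⟨j', hj', rfl⟩ := mem_image_add.1 hj
  obtain ⟨k', hk', rfl⟩ := mem_image_add.1 hk
  obtain ⟨l', hl', rfl⟩ := mem_image_add.1 hl
  exact γ.2.1 P' hP' Q' hQ' (fun h => hPQ (by rw [h]))
    ⟨i', j', k', l', by omega, by omega, by omega, hi', hk', hj', hl'⟩

/-- `γ̃ ∈ NC₂(n+2)`: `γ` nested inside the outer block `(1, n+2)`. -/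
def nest {n : ℕ} (γ : NC2 n) : NC2 (n + 2) :=
  ofBlocks (insert {1, n + 2} (shift 1 γ.blocks))
    (by
      intro P hP a ha
      rw [Finset.mem_Icc]
      rcases Finset.mem_insert.1 hP with rfl | hP
      · simp only [Finset.mem_insert, Finset.mem_singleton] at ha
        omega
      · have := γ.shift_range hP ha
        omega)
    (by
      intro a ha
      rw [Finset.mem_Icc] at ha
      by_cases h : a = 1 ∨ a = n + 2
      · exact ⟨_, Finset.mem_insert_self _ _, by simpa using h⟩
      · obtain ⟨P, hP, haP⟩ := γ.shift_cover (s := 1) (a := a) (by omega) (by omega)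
        exact ⟨P, Finset.mem_insert_of_mem hP, haP⟩)
    (by
      intro P hP Q hQ a haP haQ
      rcases Finset.mem_insert.1 hP with rfl | hP <;> rcases Finset.mem_insert.1 hQ with rfl | hQ
      · rfl
      · simp only [Finset.mem_insert, Finset.mem_singleton] at haP
        have := γ.shift_range hQ haQ
        omega
      · simp only [Finset.mem_insert, Finset.mem_singleton] at haQ
        have := γ.shift_range hP haP
        omega
      · exact γ.shift_disj hP hQ haP haQ)
    (by
      intro P hP
      rcases Finset.mem_insert.1 hP with rfl | hP
      · exact Finset.card_pair (by omega)
      · exact γ.shift_card hP)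
    (by
      intro P hP Q hQ hPQ
      rcases Finset.mem_insert.1 hP with rfl | hP <;> rcases Finset.mem_insert.1 hQ with rfl | hQ
      · exact absurd rfl hPQ
      · rintro ⟨i, j, k, l, hij, hjk, hkl, hi, hk, hj, hl⟩
        simp only [Finset.mem_insert, Finset.mem_singleton] at hi hk
        have := γ.shift_range hQ hl
        omega
      · rintro ⟨i, j, k, l, hij, hjk, hkl, hi, hk, hj, hl⟩
        simp only [Finset.mem_insert, Finset.mem_singleton] at hj hl
        have := γ.shift_range hP hi
        omega
      · exact γ.shift_nonCrossing hP hQ hPQ)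

/-- `γ₁ ⊕ γ₂ ∈ NC₂(n+m)`: juxtaposition of `γ₁` and `γ₂`, in this order. -/
def oplus {n m : ℕ} (γ₁ : NC2 n) (γ₂ : NC2 m) : NC2 (n + m) :=
  ofBlocks (γ₁.blocks ∪ shift n γ₂.blocks)
    (by
      intro P hP a ha
      rw [Finset.mem_Icc]
      rcases Finset.mem_union.1 hP with hP | hP
      · have := Finset.mem_Icc.1 (γ₁.blocks_subset hP ha)
        omega
      · have := γ₂.shift_range hP ha
        omega)
    (by
      intro a ha
      rw [Finset.mem_Icc] at ha
      by_cases h : a ≤ n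
      · obtain ⟨P, hP, haP⟩ := γ₁.blocks_cover (a := a) (Finset.mem_Icc.2 ⟨ha.1, h⟩)
        exact ⟨P, Finset.mem_union_left _ hP, haP⟩
      · obtain ⟨P, hP, haP⟩ := γ₂.shift_cover (s := n) (a := a) (by omega) (by omega)
        exact ⟨P, Finset.mem_union_right _ hP, haP⟩)
    (by
      intro P hP Q hQ a haP haQ
      rcases Finset.mem_union.1 hP with hP | hP <;> rcases Finset.mem_union.1 hQ with hQ | hQ
      · exact γ₁.blocks_disj hP hQ haP haQ
      · have := Finset.mem_Icc.1 (γ₁.blocks_subset hP haP)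
        have := γ₂.shift_range hQ haQ
        omega
      · have := Finset.mem_Icc.1 (γ₁.blocks_subset hQ haQ)
        have := γ₂.shift_range hP haP
        omega
      · exact γ₂.shift_disj hP hQ haP haQ)
    (by
      intro P hP
      rcases Finset.mem_union.1 hP with hP | hP
      · exact γ₁.blocks_card hP
      · exact γ₂.shift_card hP)
    (by
      intro P hP Q hQ hPQ
      rcases Finset.mem_union.1 hP with hP | hP <;> rcases Finset.mem_union.1 hQ with hQ | hQ
      · exact γ₁.2.1 P hP Q hQ hPQ
      · rintro ⟨i, j, k, l, hij, hjk, hkl, hi, hk, hj, hl⟩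
        have := Finset.mem_Icc.1 (γ₁.blocks_subset hP hk)
        have := γ₂.shift_range hQ hj
        omega
      · rintro ⟨i, j, k, l, hij, hjk, hkl, hi, hk, hj, hl⟩
        have := Finset.mem_Icc.1 (γ₁.blocks_subset hQ hj)
        have := γ₂.shift_range hP hi
        omega
      · exact γ₂.shift_nonCrossing hP hQ hPQ)

end NC2

/-- The recurrences for the weights `V(γ, b)`, `γ ∈ NC₂(n)`, `n ≥ 1`, `b ∈ R`, attached to a map
`η : R → R`. (The empty partition carries no weight, so `V 0` is left unconstrained.) -/
structure IsArcsineWeight {R : Type*} [Ring R] [Module ℂ R] (η : R → R)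
    (V : ∀ n : ℕ, NC2 n → R → R) : Prop where
  pair : ∀ b : R, V 2 NC2.pair b = η b
  oplus : ∀ (n m : ℕ) (γ₁ : NC2 n) (γ₂ : NC2 m) (b : R), 0 < n → 0 < m →
    V (n + m) (γ₁.oplus γ₂) b = V n γ₁ b * b * V m γ₂ b
  nest : ∀ (n : ℕ) (γ : NC2 n) (b : R), 0 < n →
    V (n + 2) γ.nest b = (1 / ((γ.numBlocks : ℂ) + 1)) • η (b * V n γ b * b)

end

/-! Put `S_N = X_0 + ... + X_{N-1}` (not normalized). In `S_{N+1} = S_N + X_N` the last variable has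
the largest index, so the peak rule replaces each maximal run of `X_N` by its expectation. Hence
`E(q(S_{N+1})) = E((T q)(S_N))`, where `T = integrate μ` depends only on the common distribution
`μ`: it sums over all choices of the occurrences of `𝒳` that are retained and integrates the runs
between them. Iterating down to `S_0 = 0` expresses `E(q(S_N))` as the free term of `T^N q`
(`distribution_sum_range`).

Write `T = 1 + D` (`integrateSubOne`). Centering kills runs of a single letter, so `D` lowers the
degree by at least two, and up to terms that lose three or more degrees it is `contract η`, which
replaces one adjacent pair `𝒳 b 𝒳` by `η b`. For `q` homogeneous of degree `n`, the moment of the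
normalized sum is therefore `N^(-n/2)` times the sum of `C(N,k) freeTerm(D^k q)` over `k ≤ n/2`.
Only `k = n/2` survives in the limit, with weight `1/k!`, and there `D^k q` equals `contract η ^ k`
applied to `q`. The limit is the free term of the exponential of `contract η` (`arcsine`), which
sees nothing but `η`. Positivity and the bimodule property pass to the limit.

For the moment formula, `freeTerm ∘ contract η ^ k` sums over the orders in which `k` pairs can be
contracted; a block can be contracted only after the blocks nested inside it. Among a block and the
`i` blocks it covers, the outer one comes last in a fraction `1/(i+1)` of all orders, which is the
factor in the third recurrence. The algebraic form of this is `contractMoment_succ_cons`, a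
decomposition according to the partner of the first letter. On constant words it becomes the
recursion over binary trees (left subtree nested in the first block, right subtree following it),
and `toTree` identifies `NC₂(2k)` with the trees with `k` nodes.

`B⟨𝒳⟩` is known only through its universal property, so the operators are obtained by letting it act
on a module of states that processes a word from right to left. -/

noncomputable section

namespace NCPoly

/-! ### Contraction and partial integration as linear operators on `B⟨𝒳⟩`. -/

section operators

variable {B : Type*} [Ring B] [Algebra ℂ B]

/-- Induction on a polynomial by multiplying on the left with coefficients and with `𝒳`. -/
theorem induction_left {P : NCPoly B → Prop} (h1 : P 1)
    (hC : ∀ b q, P q → P (coeff B b * q)) (hX : ∀ q, P q → P (X B * q))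
    (hadd : ∀ p q, P p → P q → P (p + q)) (p : NCPoly B) : P p := by
  have key : ∀ q, P q → P (p * q) := by
    induction p using NCPoly.induction with
    | hC b => exact hC b
    | hX => exact hX
    | hadd p q hp hq =>
      intro r hr
      rw [add_mul]
      exact hadd _ _ (hp r hr) (hq r hr)
    | hmul p q hp hq =>
      intro r hr
      rw [mul_assoc]
      exact hp _ (hq r hr)
  simpa using key 1 h1

/-- The state space of a transducer reading a polynomial: the output, the output as a function of
the factor currently read, and the input. -/
abbrev TransducerState (K P : Type*) [Ring K] [Algebra ℂ K] [Ring P] [Algebra ℂ P] : Type _ :=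
  P × (K →ₗ[ℂ] P) × P

variable {K P : Type*} [Ring K] [Algebra ℂ K] [Ring P] [Algebra ℂ P]

/-- The action of the coefficients on the states of a transducer. -/
def transducerCoeff (j : B →ₐ[ℂ] K) (i : B →ₐ[ℂ] P) :
    B →ₐ[ℂ] Module.End ℂ (TransducerState K P) :=
  AlgHom.ofLinearMap
    { toFun := fun b => (LinearMap.mulLeft ℂ (i b)).prodMap
        ((LinearMap.lcomp ℂ P (LinearMap.mulRight ℂ (j b))).prodMap
          (LinearMap.mulLeft ℂ (i b)))
      map_add' := fun b c => by
        refine LinearMap.ext fun ⟨u, κ, p⟩ => ?_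
        refine Prod.ext ?_ (Prod.ext (LinearMap.ext fun x => ?_) ?_) <;>
          simp [add_mul, mul_add]
      map_smul' := fun z b => by
        refine LinearMap.ext fun ⟨u, κ, p⟩ => ?_
        refine Prod.ext ?_ (Prod.ext (LinearMap.ext fun x => ?_) ?_) <;> simp }
    (by
      refine LinearMap.ext fun ⟨u, κ, p⟩ => ?_
      refine Prod.ext ?_ (Prod.ext (LinearMap.ext fun x => ?_) ?_) <;> simp)
    (fun b c => by
      refine LinearMap.ext fun ⟨u, κ, p⟩ => ?_
      refine Prod.ext ?_ (Prod.ext (LinearMap.ext fun x => ?_) ?_) <;> simp [mul_assoc])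

/-- The run of a transducer with transition `x` on the letter `𝒳` from the initial state `s`. -/
def transducerRun (j : B →ₐ[ℂ] K) (i : B →ₐ[ℂ] P) (x : Module.End ℂ (TransducerState K P))
    (s : TransducerState K P) : NCPoly B →ₗ[ℂ] TransducerState K P :=
  (LinearMap.applyₗ s) ∘ₗ (eval (transducerCoeff j i) x).toLinearMap

section run

variable (j : B →ₐ[ℂ] K) (i : B →ₐ[ℂ] P) (x : Module.End ℂ (TransducerState K P))
  (s : TransducerState K P)

theorem transducerRun_one : transducerRun j i x s 1 = s := by
  simp [transducerRun]

theorem transducerRun_coeff_mul (b : B) (q : NCPoly B) :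
    transducerRun j i x s (coeff B b * q) = transducerCoeff j i b (transducerRun j i x s q) := by
  simp [transducerRun, eval_coeff]

theorem transducerRun_X_mul (q : NCPoly B) :
    transducerRun j i x s (X B * q) = x (transducerRun j i x s q) := by
  simp [transducerRun, eval_X]

theorem transducerCoeff_fst (b : B) : (transducerCoeff j i b s).1 = i b * s.1 := rfl

theorem transducerCoeff_snd_fst (b : B) (c : K) :
    (transducerCoeff j i b s).2.1 c = s.2.1 (c * j b) := rfl

theorem transducerCoeff_snd_snd (b : B) : (transducerCoeff j i b s).2.2 = i b * s.2.2 := rfl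

end run

/-! #### Contraction of adjacent pairs -/

/-- The transition of the transducer contracting one adjacent pair `𝒳 b 𝒳` to `η b`. -/
def contractStep (i : B →ₐ[ℂ] P) (x : P) (η : B →ₗ[ℂ] B) : Module.End ℂ (TransducerState B P) where
  -- The pending function sends `c` to the result of contracting the letter just read with a further
  -- `𝒳` on its left, `c` being the coefficient between them. The next `𝒳` evaluates it at `1`,
  -- since `transducerCoeff` has already multiplied the intervening coefficients into its argument.
  toFun s := (x * s.1 + s.2.1 1, (LinearMap.mulRight ℂ s.2.2) ∘ₗ i.toLinearMap ∘ₗ η, x * s.2.2)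
  map_add' s t := by
    refine Prod.ext ?_ (Prod.ext (LinearMap.ext fun x => ?_) ?_)
    · simp [mul_add]; abel
    · simp [mul_add]
    · simp [mul_add]
  map_smul' z s := by
    refine Prod.ext ?_ (Prod.ext (LinearMap.ext fun x => ?_) ?_) <;> simp

/-- The final state of the transducer contracting one adjacent pair. -/
def contractRun (i : B →ₐ[ℂ] P) (x : P) (η : B →ₗ[ℂ] B) :
    NCPoly B →ₗ[ℂ] TransducerState B P :=
  transducerRun (AlgHom.id ℂ B) i (contractStep i x η) (0, 0, 1)

theorem contractRun_one (i : B →ₐ[ℂ] P) (x : P) (η : B →ₗ[ℂ] B) :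
    contractRun i x η 1 = (0, 0, 1) :=
  transducerRun_one _ _ _ _

theorem contractRun_coeff_mul (i : B →ₐ[ℂ] P) (x : P) (η : B →ₗ[ℂ] B) (b : B) (q : NCPoly B) :
    contractRun i x η (coeff B b * q) =
      transducerCoeff (AlgHom.id ℂ B) i b (contractRun i x η q) :=
  transducerRun_coeff_mul _ _ _ _ _ _

theorem contractRun_X_mul (i : B →ₐ[ℂ] P) (x : P) (η : B →ₗ[ℂ] B) (q : NCPoly B) :
    contractRun i x η (X B * q) = contractStep i x η (contractRun i x η q) :=
  transducerRun_X_mul _ _ _ _ _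

/-- The input is carried along because contracting a pair returns the unmodified polynomial on its
right. -/
theorem contractRun_snd_snd (i : B →ₐ[ℂ] P) (x : P) (η : B →ₗ[ℂ] B) (q : NCPoly B) :
    (contractRun i x η q).2.2 = eval i x q := by
  induction q using induction_left with
  | h1 => rw [contractRun_one, map_one]
  | hC b q ih => rw [contractRun_coeff_mul, transducerCoeff_snd_snd, ih, map_mul, eval_coeff]
  | hX q ih =>
    rw [contractRun_X_mul, map_mul, eval_X]
    exact congrArg (x * ·) ih
  | hadd p q hp hq => rw [map_add, Prod.snd_add, Prod.snd_add, hp, hq, map_add]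

theorem eval_coeff_X (q : NCPoly B) : eval (coeff B) (X B) q = q := by
  induction q using NCPoly.induction with
  | hC b => rw [eval_coeff]
  | hX => rw [eval_X]
  | hadd p q hp hq => rw [map_add, hp, hq]
  | hmul p q hp hq => rw [map_mul, hp, hq]

/-- The sum over all adjacent pairs `𝒳 b 𝒳` of a monomial of the monomials in which the pair is
replaced by `η b`. -/
def contract (η : B →ₗ[ℂ] B) : NCPoly B →ₗ[ℂ] NCPoly B where
  toFun q := (contractRun (coeff B) (X B) η q).1
  map_add' p q := by rw [map_add]; rfl
  map_smul' z q := by rw [map_smul]; rfl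

theorem contract_apply (η : B →ₗ[ℂ] B) (q : NCPoly B) :
    contract η q = (contractRun (coeff B) (X B) η q).1 := rfl

theorem contract_one (η : B →ₗ[ℂ] B) : contract η 1 = 0 := by
  rw [contract_apply, contractRun_one]

theorem contract_coeff_mul (η : B →ₗ[ℂ] B) (b : B) (q : NCPoly B) :
    contract η (coeff B b * q) = coeff B b * contract η q := by
  rw [contract_apply, contractRun_coeff_mul, transducerCoeff_fst, contract_apply]

theorem contract_X_mul_coeff (η : B →ₗ[ℂ] B) (b : B) :
    contract η (X B * coeff B b) = 0 := by
  rw [← mul_one (coeff B b), contract_apply, contractRun_X_mul, contractRun_coeff_mul,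
    contractRun_one]
  change X B * (coeff B b * 0) + 0 = (0 : NCPoly B)
  simp

/-- The leading letter is either left alone or contracted with its right neighbour. With the cases
of no letter and of a single letter, this determines `contract`. -/
theorem contract_X_mul_coeff_mul_X_mul (η : B →ₗ[ℂ] B) (b : B) (q : NCPoly B) :
    contract η (X B * (coeff B b * (X B * q))) =
      X B * (coeff B b * contract η (X B * q)) + coeff B (η b) * q := by
  have h := contractRun_snd_snd (coeff B) (X B) η q
  rw [eval_coeff_X] at h
  simp only [contract_apply, contractRun_coeff_mul, contractRun_X_mul]
  set s := contractRun (coeff B) (X B) η q with hs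
  change X B * (coeff B b * (contractStep (coeff B) (X B) η s).1) +
    coeff B (η (1 * b)) * s.2.2 = _
  rw [h, one_mul]

/-! #### Partial integration -/

/-- The transition of the transducer integrating the factors between the retained letters. -/
def integrateStep (y : K) (i : B →ₐ[ℂ] P) (x : P) (μ : K →ₗ[ℂ] B) :
    Module.End ℂ (TransducerState K P) where
  -- The letter is either retained or opens a factor to be integrated. If a factor `c` is already
  -- open on its left, the letter either extends it to `c * y` or is retained and closes it,
  -- contributing `μ c`.
  toFun s := (x * s.1 + s.2.1 y,
    s.2.1 ∘ₗ LinearMap.mulRight ℂ y +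
      (LinearMap.mulRight ℂ (x * s.1)) ∘ₗ i.toLinearMap ∘ₗ μ, x * s.2.2)
  map_add' s t := by
    refine Prod.ext ?_ (Prod.ext (LinearMap.ext fun x => ?_) ?_)
    · simp [mul_add]; abel
    · simp [mul_add, ← mul_assoc]; abel
    · simp [mul_add]
  map_smul' z s := by
    refine Prod.ext ?_ (Prod.ext (LinearMap.ext fun x => ?_) ?_) <;> simp [mul_assoc]

/-- The final state of the transducer integrating the factors between the retained letters. -/
def integrateRun (j : B →ₐ[ℂ] K) (y : K) (i : B →ₐ[ℂ] P) (x : P) (μ : K →ₗ[ℂ] B) :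
    NCPoly B →ₗ[ℂ] TransducerState K P :=
  transducerRun j i (integrateStep y i x μ) (1, i.toLinearMap ∘ₗ μ, 1)

section integrateRun

variable (j : B →ₐ[ℂ] K) (y : K) (i : B →ₐ[ℂ] P) (x : P) (μ : K →ₗ[ℂ] B)

theorem integrateRun_one : integrateRun j y i x μ 1 = (1, i.toLinearMap ∘ₗ μ, 1) :=
  transducerRun_one _ _ _ _

theorem integrateRun_coeff_mul (b : B) (q : NCPoly B) :
    integrateRun j y i x μ (coeff B b * q) =
      transducerCoeff j i b (integrateRun j y i x μ q) :=
  transducerRun_coeff_mul _ _ _ _ _ _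

theorem integrateRun_X_mul (q : NCPoly B) :
    integrateRun j y i x μ (X B * q) = integrateStep y i x μ (integrateRun j y i x μ q) :=
  transducerRun_X_mul _ _ _ _ _

end integrateRun

/-- The sum over all sets of occurrences of `𝒳` in a monomial of the monomials in which these
occurrences are retained and the maximal factors between them are replaced by their values
under `μ`. -/
def integrate (μ : NCPoly B →ₗ[ℂ] B) : NCPoly B →ₗ[ℂ] NCPoly B where
  toFun q := (integrateRun (coeff B) (X B) (coeff B) (X B) μ q).1
  map_add' p q := by rw [map_add]; rfl
  map_smul' z q := by rw [map_smul]; rfl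

/-- The variant of `integrate` for `c * q`, in which no occurrence of `𝒳` in `c` is retained. -/
def integrateAfter (μ : NCPoly B →ₗ[ℂ] B) (q c : NCPoly B) : NCPoly B :=
  (integrateRun (coeff B) (X B) (coeff B) (X B) μ q).2.1 c

section integrate

variable (μ : NCPoly B →ₗ[ℂ] B)

theorem integrate_apply (q : NCPoly B) :
    integrate μ q = (integrateRun (coeff B) (X B) (coeff B) (X B) μ q).1 := rfl

theorem integrate_one : integrate μ 1 = 1 := by
  rw [integrate_apply, integrateRun_one]

theorem integrate_coeff_mul (b : B) (q : NCPoly B) :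
    integrate μ (coeff B b * q) = coeff B b * integrate μ q := by
  rw [integrate_apply, integrateRun_coeff_mul, transducerCoeff_fst, integrate_apply]

theorem integrate_X_mul (q : NCPoly B) :
    integrate μ (X B * q) = X B * integrate μ q + integrateAfter μ q (X B) := by
  rw [integrate_apply, integrateRun_X_mul]
  rfl

theorem integrateAfter_one (c : NCPoly B) : integrateAfter μ 1 c = coeff B (μ c) := by
  rw [integrateAfter, integrateRun_one]
  rfl

theorem integrateAfter_coeff_mul (b : B) (q c : NCPoly B) :
    integrateAfter μ (coeff B b * q) c = integrateAfter μ q (c * coeff B b) := by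
  rw [integrateAfter, integrateRun_coeff_mul, transducerCoeff_snd_fst, integrateAfter]

theorem integrateAfter_X_mul (q c : NCPoly B) :
    integrateAfter μ (X B * q) c =
      integrateAfter μ q (c * X B) + coeff B (μ c) * (X B * integrate μ q) := by
  rw [integrateAfter, integrateRun_X_mul]
  rfl

theorem integrateAfter_add (p q c : NCPoly B) :
    integrateAfter μ (p + q) c = integrateAfter μ p c + integrateAfter μ q c := by
  rw [integrateAfter, map_add]
  rfl

end integrate

end operators

end NCPoly

end

noncomputable section

namespace NCPoly

/-! ### Degree estimates for the two operators. -/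

section degree

variable {B : Type*} [Ring B] [Algebra ℂ B]

/-- The monomial `𝒳 b₁ 𝒳 b₂ ⋯ 𝒳 bₙ`. -/
def mono : List B → NCPoly B
  | [] => 1
  | b :: l => X B * (coeff B b * mono l)

theorem mono_nil : mono ([] : List B) = 1 := rfl

theorem mono_cons (b : B) (l : List B) : mono (b :: l) = X B * (coeff B b * mono l) := rfl

variable (B) in
/-- The span of the monomials `b₀ 𝒳 b₁ ⋯ 𝒳 bₙ` whose degree `n` satisfies `S`. -/
def degreeSpan (S : ℤ → Prop) : Submodule ℂ (NCPoly B) :=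
  Submodule.span ℂ {p | ∃ b l, S (List.length l) ∧ p = coeff B b * mono l}

variable (B) in
/-- The polynomials of degree at most `n`. -/
abbrev degreeLE (n : ℤ) : Submodule ℂ (NCPoly B) := degreeSpan B (· ≤ n)

variable (B) in
/-- The homogeneous polynomials of degree `n`. -/
abbrev homogeneous (n : ℤ) : Submodule ℂ (NCPoly B) := degreeSpan B (· = n)

theorem degreeSpan_mono {S T : ℤ → Prop} (h : ∀ n, S n → T n) :
    degreeSpan B S ≤ degreeSpan B T :=
  Submodule.span_mono (by rintro _ ⟨b, l, hl, rfl⟩; exact ⟨b, l, h _ hl, rfl⟩)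

theorem mono_mem {S : ℤ → Prop} {l : List B} (h : S l.length) : mono l ∈ degreeSpan B S :=
  Submodule.subset_span ⟨1, l, h, by simp⟩

theorem coeff_mul_mem {S : ℤ → Prop} {p : NCPoly B} (hp : p ∈ degreeSpan B S) (b : B) :
    coeff B b * p ∈ degreeSpan B S := by
  induction hp using Submodule.span_induction with
  | mem x hx =>
    obtain ⟨c, l, hl, rfl⟩ := hx
    exact Submodule.subset_span ⟨b * c, l, hl, by rw [map_mul, mul_assoc]⟩
  | zero => rw [mul_zero]; exact zero_mem _
  | add x y _ _ hx hy => rw [mul_add]; exact add_mem hx hy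
  | smul z x _ hx => rw [mul_smul_comm]; exact Submodule.smul_mem _ _ hx

theorem X_mul_mem {S T : ℤ → Prop} (h : ∀ n, S n → T (n + 1)) {p : NCPoly B}
    (hp : p ∈ degreeSpan B S) : X B * p ∈ degreeSpan B T := by
  induction hp using Submodule.span_induction with
  | mem x hx =>
    obtain ⟨c, l, hl, rfl⟩ := hx
    exact mono_mem (l := c :: l) (by simpa using h _ hl)
  | zero => rw [mul_zero]; exact zero_mem _
  | add x y _ _ hx hy => rw [mul_add]; exact add_mem hx hy
  | smul z x _ hx => rw [mul_smul_comm]; exact Submodule.smul_mem _ _ hx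

theorem X_mul_mem_degreeLE {n k : ℤ} (h : n + 1 ≤ k) {p : NCPoly B} (hp : p ∈ degreeLE B n) :
    X B * p ∈ degreeLE B k :=
  X_mul_mem (fun _ hm => by omega) hp

theorem X_mul_mem_homogeneous {n k : ℤ} (h : n + 1 = k) {p : NCPoly B}
    (hp : p ∈ homogeneous B n) : X B * p ∈ homogeneous B k :=
  X_mul_mem (fun _ hm => by omega) hp

/-- Degrees are integers so that subtraction is not truncated: a bound that has become negative
forces a polynomial to vanish. -/
theorem degreeLE_eq_bot {n : ℤ} (hn : n < 0) : degreeLE B n = ⊥ := by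
  refine Submodule.span_eq_bot.2 ?_
  rintro _ ⟨b, l, hl, rfl⟩
  omega

/-- A property closed under sums that holds for all homogeneous polynomials holds for all
polynomials. -/
theorem induction_homogeneous {P : NCPoly B → Prop}
    (hH : ∀ n : ℕ, ∀ p ∈ homogeneous B n, P p)
    (hadd : ∀ p q, P p → P q → P (p + q)) (p : NCPoly B) : P p := by
  have key : p ∈ degreeSpan B (fun _ => True) := by
    induction p using induction_left with
    | h1 => exact mono_mem (l := []) trivial
    | hC b q ih => exact coeff_mul_mem ih b
    | hX q ih => exact X_mul_mem (fun _ _ => trivial) ih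
    | hadd p q hp hq => exact add_mem hp hq
  suffices h : ∀ z : ℂ, P (z • p) by simpa using h 1
  refine Submodule.span_induction (p := fun p _ => ∀ z : ℂ, P (z • p)) ?_ ?_ ?_ ?_ key
  · rintro _ ⟨b, l, -, rfl⟩ z
    exact hH l.length _ (Submodule.smul_mem _ _ (Submodule.subset_span ⟨b, l, rfl, rfl⟩))
  · intro z
    rw [smul_zero]
    exact hH 0 0 (zero_mem _)
  · intro x y _ _ hx hy z
    rw [smul_add]
    exact hadd _ _ (hx z) (hy z)
  · intro w x _ hx z
    rw [smul_smul]
    exact hx _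

/-- The free term of a polynomial. -/
def freeTerm : NCPoly B →ₗ[ℂ] B := (eval (AlgHom.id ℂ B) 0).toLinearMap

theorem freeTerm_coeff_mul (b : B) (p : NCPoly B) :
    freeTerm (coeff B b * p) = b * freeTerm p := by
  simp [freeTerm, eval_coeff]

theorem freeTerm_X_mul (p : NCPoly B) : freeTerm (X B * p) = 0 := by
  simp [freeTerm, eval_X]

theorem freeTerm_one : freeTerm (1 : NCPoly B) = 1 := by
  simp [freeTerm]

theorem freeTerm_of_mem_homogeneous {n : ℤ} (hn : n ≠ 0) {p : NCPoly B}
    (hp : p ∈ homogeneous B n) : freeTerm p = 0 := by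
  induction hp using Submodule.span_induction with
  | mem x hx =>
    obtain ⟨c, l, hl, rfl⟩ := hx
    cases l with
    | nil => exact absurd hl.symm (by simpa using hn)
    | cons b l => rw [freeTerm_coeff_mul, mono_cons, freeTerm_X_mul, mul_zero]
  | zero => rw [map_zero]
  | add x y _ _ hx hy => rw [map_add, hx, hy, add_zero]
  | smul z x _ hx => rw [map_smul, hx, smul_zero]

theorem eval_smul_of_mem_homogeneous {A : Type*} [Ring A] [Algebra ℂ A] (ι : B →ₐ[ℂ] A) (a : A)
    (z : ℂ) {n : ℕ} {p : NCPoly B} (hp : p ∈ homogeneous B n) :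
    eval ι (z • a) p = z ^ n • eval ι a p := by
  induction hp using Submodule.span_induction with
  | mem x hx =>
    obtain ⟨c, l, hl, rfl⟩ := hx
    have key : eval ι (z • a) (mono l) = z ^ l.length • eval ι a (mono l) := by
      clear hl
      induction l with
      | nil => simp [mono_nil]
      | cons b l ih =>
        simp [mono_cons, eval_X, eval_coeff, ih, pow_succ, smul_smul]
    obtain rfl : l.length = n := by exact_mod_cast hl
    rw [map_mul, map_mul, key, eval_coeff, eval_coeff, mul_smul_comm]
  | zero => simp
  | add x y _ _ hx hy => rw [map_add, hx, hy, map_add, smul_add]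
  | smul w x _ hx => rw [map_smul, hx, map_smul, smul_comm]

/-! #### Degrees of the operators -/

/-- To check a degree bound for a left `B`-linear map it suffices to treat monomials. -/
theorem map_mem_of_mono (f : NCPoly B →ₗ[ℂ] NCPoly B)
    (hf : ∀ b q, f (coeff B b * q) = coeff B b * f q) {S T : ℤ → Prop}
    (h : ∀ l : List B, S l.length → f (mono l) ∈ degreeSpan B T) {p : NCPoly B}
    (hp : p ∈ degreeSpan B S) : f p ∈ degreeSpan B T := by
  induction hp using Submodule.span_induction with
  | mem x hx =>
    obtain ⟨c, l, hl, rfl⟩ := hx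
    rw [hf]
    exact coeff_mul_mem (h l hl) c
  | zero => rw [map_zero]; exact zero_mem _
  | add x y _ _ hx hy => rw [map_add]; exact add_mem hx hy
  | smul w x _ hx => rw [map_smul]; exact Submodule.smul_mem _ _ hx

theorem contract_mono_cons_cons (η : B →ₗ[ℂ] B) (b c : B) (l : List B) :
    contract η (mono (b :: c :: l)) =
      X B * (coeff B b * contract η (mono (c :: l))) + coeff B (η b * c) * mono l := by
  rw [mono_cons, mono_cons, contract_X_mul_coeff_mul_X_mul, map_mul (coeff B), mul_assoc]

theorem contract_mono_mem (η : B →ₗ[ℂ] B) (l : List B) :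
    contract η (mono l) ∈ homogeneous B (l.length - 2) := by
  induction l with
  | nil => rw [mono_nil, contract_one]; exact zero_mem _
  | cons b l ih =>
    cases l with
    | nil =>
      rw [mono_cons, mono_nil, mul_one, contract_X_mul_coeff]
      exact zero_mem _
    | cons c l =>
      rw [contract_mono_cons_cons]
      refine add_mem (X_mul_mem_homogeneous ?_ (coeff_mul_mem ih b)) (coeff_mul_mem (mono_mem ?_) _)
      · simp only [List.length_cons]; push_cast; ring
      · simp only [List.length_cons]; push_cast; ring

theorem contract_mem_homogeneous (η : B →ₗ[ℂ] B) {n : ℤ} {p : NCPoly B}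
    (hp : p ∈ homogeneous B n) : contract η p ∈ homogeneous B (n - 2) :=
  map_mem_of_mono _ (contract_coeff_mul η) (by rintro l rfl; exact contract_mono_mem η l) hp

theorem contract_mem_degreeLE (η : B →ₗ[ℂ] B) {n : ℤ} {p : NCPoly B}
    (hp : p ∈ degreeLE B n) : contract η p ∈ degreeLE B (n - 2) :=
  map_mem_of_mono _ (contract_coeff_mul η)
    (fun l hl => degreeSpan_mono (fun m hm => by omega) (contract_mono_mem η l)) hp

theorem contract_pow_mem_homogeneous (η : B →ₗ[ℂ] B) (k : ℕ) {n : ℤ} {p : NCPoly B}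
    (hp : p ∈ homogeneous B n) : (contract η ^ k) p ∈ homogeneous B (n - 2 * k) := by
  induction k with
  | zero => simpa using hp
  | succ k ih =>
    rw [pow_succ', Module.End.mul_apply]
    refine degreeSpan_mono (fun m hm => ?_) (contract_mem_homogeneous η ih)
    push_cast
    omega

theorem freeTerm_contract_pow_of_ne (η : B →ₗ[ℂ] B) {k n : ℕ} (h : n ≠ 2 * k) {p : NCPoly B}
    (hp : p ∈ homogeneous B n) : freeTerm ((contract η ^ k) p) = 0 :=
  freeTerm_of_mem_homogeneous (by omega) (contract_pow_mem_homogeneous η k hp)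

section integrate

variable {μ : NCPoly B →ₗ[ℂ] B}

theorem integrate_mono_cons (b : B) (l : List B) :
    integrate μ (mono (b :: l)) =
      X B * (coeff B b * integrate μ (mono l)) + integrateAfter μ (mono l) (X B * coeff B b) := by
  rw [mono_cons, integrate_X_mul, integrate_coeff_mul, integrateAfter_coeff_mul]

theorem integrateAfter_mono_cons (b : B) (l : List B) (c : NCPoly B) :
    integrateAfter μ (mono (b :: l)) c = integrateAfter μ (mono l) (c * (X B * coeff B b)) +
      coeff B (μ c) * (X B * (coeff B b * integrate μ (mono l))) := by
  rw [mono_cons, integrateAfter_X_mul, integrate_coeff_mul, integrateAfter_coeff_mul, mul_assoc]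

theorem integrate_mono_mem_and_integrateAfter_mono_mem (l : List B) :
    integrate μ (mono l) ∈ degreeLE B l.length ∧
      ∀ c, integrateAfter μ (mono l) c ∈ degreeLE B l.length := by
  induction l with
  | nil =>
    refine ⟨by rw [mono_nil, integrate_one]; exact mono_mem (l := []) (by simp), fun c => ?_⟩
    rw [mono_nil, integrateAfter_one, ← mul_one (coeff B _)]
    exact coeff_mul_mem (mono_mem (l := []) (by simp)) _
  | cons b l ih =>
    have h : ∀ c, integrateAfter μ (mono l) c ∈ degreeLE B (b :: l).length := fun c =>
      degreeSpan_mono (fun m hm => by simp only [List.length_cons]; push_cast; omega) (ih.2 c)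
    have h' : X B * (coeff B b * integrate μ (mono l)) ∈ degreeLE B (b :: l).length :=
      X_mul_mem_degreeLE (by simp) (coeff_mul_mem ih.1 b)
    refine ⟨?_, fun c => ?_⟩
    · rw [integrate_mono_cons]
      exact add_mem h' (h _)
    · rw [integrateAfter_mono_cons]
      exact add_mem (h _) (coeff_mul_mem h' _)

/-- A run consisting of the single letter `𝒳 b` has expectation zero, so at least one more letter is
lost from the list. -/
theorem integrateAfter_mono_X_mul_coeff_mem (hμ₁ : ∀ b, μ (X B * coeff B b) = 0)
    (b : B) (l : List B) :
    integrateAfter μ (mono l) (X B * coeff B b) ∈ degreeLE B (l.length - 1) := by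
  cases l with
  | nil => rw [mono_nil, integrateAfter_one, hμ₁, map_zero]; exact zero_mem _
  | cons c l =>
    rw [integrateAfter_mono_cons, hμ₁, map_zero, zero_mul, add_zero]
    exact degreeSpan_mono (fun m hm => by simp only [List.length_cons]; push_cast; omega)
      ((integrate_mono_mem_and_integrateAfter_mono_mem l).2 _)

/-- The subtracted monomial is the term in which every letter is retained; in every other
nonvanishing term some run of at least two letters is integrated. -/
theorem integrate_sub_self_mono_mem (hμ₁ : ∀ b, μ (X B * coeff B b) = 0)
    (l : List B) :
    integrate μ (mono l) - mono l ∈ degreeLE B (l.length - 2) := by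
  induction l with
  | nil => rw [mono_nil, integrate_one, sub_self]; exact zero_mem _
  | cons b l ih =>
    rw [integrate_mono_cons, mono_cons, add_sub_right_comm, ← mul_sub, ← mul_sub]
    refine add_mem (X_mul_mem_degreeLE ?_ (coeff_mul_mem ih b))
      (degreeSpan_mono (fun m hm => ?_) (integrateAfter_mono_X_mul_coeff_mem hμ₁ b l))
    · simp only [List.length_cons]; push_cast; omega
    · simp only [List.length_cons]; push_cast; omega

variable {η : B →ₗ[ℂ] B}

/-- A run opened by `𝒳 b` must include `𝒳 c`. If it stops there it yields `η b * c`, and the rest is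
unchanged up to a loss of two degrees; if it goes on, a third letter is lost. -/
theorem integrateAfter_sub_mono_mem
    (hμ₁ : ∀ b, μ (X B * coeff B b) = 0)
    (hμ₂ : ∀ b c, μ (X B * coeff B b * (X B * coeff B c)) = η b * c)
    (b c : B) (l : List B) :
    integrateAfter μ (mono (c :: l)) (X B * coeff B b) - coeff B (η b * c) * mono l ∈
      degreeLE B (l.length - 1) := by
  rw [integrateAfter_mono_cons, hμ₁, map_zero, zero_mul, add_zero]
  cases l with
  | nil =>
    rw [mono_nil, integrateAfter_one, hμ₂, mul_one, sub_self]
    exact zero_mem _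
  | cons d l =>
    rw [integrateAfter_mono_cons, hμ₂, mono_cons, add_sub_assoc, ← mul_sub, ← mul_sub, ← mul_sub]
    refine add_mem (degreeSpan_mono (fun m hm => ?_)
      ((integrate_mono_mem_and_integrateAfter_mono_mem l).2 _)) (coeff_mul_mem
        (X_mul_mem_degreeLE ?_ (coeff_mul_mem (integrate_sub_self_mono_mem hμ₁ l) d)) _)
    · simp only [List.length_cons]; push_cast; omega
    · simp only [List.length_cons]; push_cast; omega

/-- Losing exactly two letters means integrating one adjacent pair, which is what `contract η` does;
all remaining terms lose at least three. -/
theorem integrate_sub_self_sub_contract_mono_mem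
    (hμ₁ : ∀ b, μ (X B * coeff B b) = 0)
    (hμ₂ : ∀ b c, μ (X B * coeff B b * (X B * coeff B c)) = η b * c)
    (l : List B) :
    integrate μ (mono l) - mono l - contract η (mono l) ∈ degreeLE B (l.length - 3) := by
  induction l with
  | nil =>
    rw [mono_nil, integrate_one, sub_self, contract_one, sub_self]
    exact zero_mem _
  | cons b l ih =>
    cases l with
    | nil =>
      rw [integrate_mono_cons, mono_cons, mono_nil, integrate_one, mul_one, contract_X_mul_coeff,
        integrateAfter_one, hμ₁, map_zero, add_zero, sub_self, sub_self]
      exact zero_mem _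
    | cons c l =>
      have e : integrate μ (mono (b :: c :: l)) - mono (b :: c :: l) -
          contract η (mono (b :: c :: l)) =
          X B * (coeff B b * (integrate μ (mono (c :: l)) - mono (c :: l) -
            contract η (mono (c :: l)))) +
          (integrateAfter μ (mono (c :: l)) (X B * coeff B b) - coeff B (η b * c) * mono l) := by
        rw [contract_mono_cons_cons, integrate_mono_cons, mono_cons b]
        simp only [mul_sub]
        abel
      rw [e]
      refine add_mem (X_mul_mem_degreeLE ?_ (coeff_mul_mem ih b))
        (degreeSpan_mono (fun m hm => ?_) (integrateAfter_sub_mono_mem hμ₁ hμ₂ b c l))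
      · simp only [List.length_cons]; push_cast; omega
      · simp only [List.length_cons] at hm ⊢; push_cast; omega

variable (μ) in
/-- The difference of `integrate μ` and the identity. -/
def integrateSubOne : NCPoly B →ₗ[ℂ] NCPoly B where
  toFun p := integrate μ p - p
  map_add' p q := by rw [map_add]; abel
  map_smul' z p := by rw [map_smul, RingHom.id_apply, smul_sub]

theorem integrate_eq_integrateSubOne_add_one : integrate μ = integrateSubOne μ + 1 :=
  LinearMap.ext fun p => (sub_add_cancel (integrate μ p) p).symm

theorem integrateSubOne_coeff_mul (b : B) (q : NCPoly B) :
    integrateSubOne μ (coeff B b * q) = coeff B b * integrateSubOne μ q := by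
  change integrate μ (coeff B b * q) - coeff B b * q = coeff B b * (integrate μ q - q)
  rw [integrate_coeff_mul, mul_sub]

theorem integrateSubOne_mem (hμ₁ : ∀ b, μ (X B * coeff B b) = 0)
    {n : ℤ} {p : NCPoly B} (hp : p ∈ degreeLE B n) :
    integrateSubOne μ p ∈ degreeLE B (n - 2) :=
  map_mem_of_mono _ integrateSubOne_coeff_mul
    (fun l hl => degreeSpan_mono (fun m hm => by omega) (integrate_sub_self_mono_mem hμ₁ l)) hp

theorem integrateSubOne_sub_contract_mem
    (hμ₁ : ∀ b, μ (X B * coeff B b) = 0)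
    (hμ₂ : ∀ b c, μ (X B * coeff B b * (X B * coeff B c)) = η b * c)
    {n : ℤ} {p : NCPoly B} (hp : p ∈ degreeLE B n) :
    integrateSubOne μ p - contract η p ∈ degreeLE B (n - 3) :=
  map_mem_of_mono
    { toFun := fun p => integrateSubOne μ p - contract η p
      map_add' := fun p q => by rw [map_add, map_add]; abel
      map_smul' := fun z p => by rw [map_smul, map_smul, RingHom.id_apply, smul_sub] }
    (fun b q => by
      change integrateSubOne μ (coeff B b * q) - contract η (coeff B b * q) =
        coeff B b * (integrateSubOne μ q - contract η q)
      rw [integrateSubOne_coeff_mul, contract_coeff_mul, mul_sub])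
    (fun l hl => degreeSpan_mono (fun m hm => by omega)
      (integrate_sub_self_sub_contract_mono_mem hμ₁ hμ₂ l)) hp

theorem integrateSubOne_pow_mem (hμ₁ : ∀ b, μ (X B * coeff B b) = 0)
    {n : ℤ} {p : NCPoly B} (hp : p ∈ degreeLE B n) (k : ℕ) :
    (integrateSubOne μ ^ k) p ∈ degreeLE B (n - 2 * k) := by
  induction k with
  | zero => simpa using hp
  | succ k ih =>
    rw [pow_succ', Module.End.mul_apply]
    exact degreeSpan_mono (fun m hm => by push_cast; omega) (integrateSubOne_mem hμ₁ ih)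

theorem integrateSubOne_pow_sub_contract_pow_mem
    (hμ₁ : ∀ b, μ (X B * coeff B b) = 0)
    (hμ₂ : ∀ b c, μ (X B * coeff B b * (X B * coeff B c)) = η b * c)
    {n : ℤ} {p : NCPoly B}
    (hp : p ∈ degreeLE B n) (k : ℕ) :
    (integrateSubOne μ ^ k) p - (contract η ^ k) p ∈ degreeLE B (n - 2 * k - 1) := by
  induction k with
  | zero => simp
  | succ k ih =>
    rw [pow_succ', pow_succ', Module.End.mul_apply, Module.End.mul_apply]
    have e : integrateSubOne μ ((integrateSubOne μ ^ k) p) - contract η ((contract η ^ k) p) =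
        (integrateSubOne μ ((integrateSubOne μ ^ k) p) - contract η ((integrateSubOne μ ^ k) p)) +
        contract η ((integrateSubOne μ ^ k) p - (contract η ^ k) p) := by
      rw [map_sub (contract η)]
      abel
    rw [e]
    refine add_mem (degreeSpan_mono (fun m hm => ?_)
      (integrateSubOne_sub_contract_mem hμ₁ hμ₂ (integrateSubOne_pow_mem hμ₁ hp k)))
      (degreeSpan_mono (fun m hm => ?_) (contract_mem_degreeLE η ih))
    · push_cast; omega
    · push_cast; omega

theorem integrateSubOne_pow_eq_zero (hμ₁ : ∀ b, μ (X B * coeff B b) = 0)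
    {n k : ℕ} (h : n < 2 * k) {p : NCPoly B}
    (hp : p ∈ homogeneous B n) : (integrateSubOne μ ^ k) p = 0 := by
  have := integrateSubOne_pow_mem hμ₁ (n := n) (degreeSpan_mono (fun m hm => hm.le) hp) k
  rwa [degreeLE_eq_bot (by omega), Submodule.mem_bot] at this

/-- The two sides differ by a polynomial of degree at most `n - 2k - 1 = -1`. -/
theorem integrateSubOne_pow_eq_contract_pow
    (hμ₁ : ∀ b, μ (X B * coeff B b) = 0)
    (hμ₂ : ∀ b c, μ (X B * coeff B b * (X B * coeff B c)) = η b * c)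
    {n k : ℕ} (h : n = 2 * k) {p : NCPoly B}
    (hp : p ∈ homogeneous B n) : (integrateSubOne μ ^ k) p = (contract η ^ k) p := by
  have := integrateSubOne_pow_sub_contract_pow_mem hμ₁ hμ₂ (n := n)
    (degreeSpan_mono (fun m hm => hm.le) hp) k
  rwa [degreeLE_eq_bot (by omega), Submodule.mem_bot, sub_eq_zero] at this

end integrate

end degree

/-! #### The limit law -/

section arcsine

variable {B : Type*} [Ring B] [Algebra ℂ B]

/-- Each contraction lowers the degree by two, so the exponential series is a finite sum on each
polynomial. Additivity of `arcsine` depends on this, as `finsum` takes the value zero on infinite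
supports. -/
theorem finite_support_contract_pow (η : B →ₗ[ℂ] B) (p : NCPoly B) :
    (Function.support fun k : ℕ =>
      ((k.factorial : ℂ)⁻¹) • freeTerm ((contract η ^ k) p)).Finite := by
  induction p using induction_homogeneous with
  | hH n p hp =>
    refine (Set.finite_Iic n).subset fun k hk => ?_
    by_contra hkn
    refine hk ?_
    have hkn : n < k := by simpa using hkn
    change (_ : ℂ) • _ = (0 : B)
    rw [freeTerm_contract_pow_of_ne η (by omega) hp, smul_zero]
  | hadd p q hp hq =>
    refine (hp.union hq).subset fun k hk => ?_
    by_contra h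
    simp only [Set.mem_union, Function.mem_support, not_or, not_not] at h
    refine hk ?_
    change (_ : ℂ) • _ = (0 : B)
    rw [map_add, map_add, smul_add, h.1, h.2, add_zero]

/-- The `B`-valued arcsine law of variance `η`: the free term of `exp (contract η)`. -/
def arcsine (η : B →ₗ[ℂ] B) : NCPoly B →ₗ[ℂ] B where
  toFun p := ∑ᶠ k : ℕ, ((k.factorial : ℂ)⁻¹) • freeTerm ((contract η ^ k) p)
  map_add' p q := by
    simp only [map_add, smul_add]
    exact finsum_add_distrib (finite_support_contract_pow η p) (finite_support_contract_pow η q)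
  map_smul' z p := by
    rw [RingHom.id_apply, smul_finsum' z (finite_support_contract_pow η p)]
    refine finsum_congr fun k => ?_
    rw [map_smul, map_smul, smul_comm]

theorem arcsine_of_even (η : B →ₗ[ℂ] B) {n k : ℕ} (h : n = 2 * k) {p : NCPoly B}
    (hp : p ∈ homogeneous B n) :
    arcsine η p = ((k.factorial : ℂ)⁻¹) • freeTerm ((contract η ^ k) p) := by
  refine finsum_eq_single _ k fun j hj => ?_
  rw [freeTerm_contract_pow_of_ne η (by omega) hp, smul_zero]

theorem arcsine_of_odd (η : B →ₗ[ℂ] B) {n : ℕ} (h : Odd n) {p : NCPoly B}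
    (hp : p ∈ homogeneous B n) : arcsine η p = 0 := by
  refine (finsum_congr fun j => ?_).trans finsum_zero
  rw [freeTerm_contract_pow_of_ne η (by rintro rfl; grind) hp, smul_zero]

end arcsine

end NCPoly

end

/-! ### Monotone independence: the peak rule and words in partial sums. -/

noncomputable section

/-- Transfers a condition on the first or last index of a list to a regrouped list with the same end
indices. -/
theorem Option.forall_mem_map_fst {I A : Type*} {P : I → Prop} {o o' : Option (I × A)}
    (h : o.map Prod.fst = o'.map Prod.fst) (ho : ∀ y ∈ o', P y.1) : ∀ y ∈ o, P y.1 := by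
  rintro y hy
  cases o' with
  | none => simp_all
  | some z =>
    obtain rfl : o = some y := hy
    have : y.1 = z.1 := by simpa using h
    rw [this]
    exact ho z rfl

section peak

variable {B A : Type*} [CStarAlgebra B] [CStarAlgebra A] {ι : B →⋆ₐ[ℂ] A} {E : A →ₗ[ℂ] B}

theorem mul_mem_polyValues₀ {a x y : A} (hx : x ∈ polyValues₀ ι a) (hy : y ∈ polyValues₀ ι a) :
    x * y ∈ polyValues₀ ι a := by
  obtain ⟨p, hp, rfl⟩ := hx
  obtain ⟨q, hq, rfl⟩ := hy
  refine ⟨p * q, ?_, map_mul _ _ _⟩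
  change NCPoly.eval _ _ _ = 0
  rw [map_mul, show NCPoly.eval (AlgHom.id ℂ B) 0 p = 0 from hp, zero_mul]

theorem mul_coeff_mem_polyValues₀ (a : A) (b : B) : a * ι b ∈ polyValues₀ ι a := by
  refine ⟨NCPoly.X B * NCPoly.coeff B b, ?_, ?_⟩
  · change NCPoly.eval _ _ _ = 0
    rw [map_mul, NCPoly.eval_X, zero_mul]
  · rw [map_mul, NCPoly.eval_X, NCPoly.eval_coeff]
    rfl

/-- A product of values of polynomials without free term can be rewritten so that consecutive
factors have different indices, with the same first and last indices. -/
theorem exists_isChain_of_mem_polyValues₀ {I : Type*} [DecidableEq I] {X : I → A}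
    (l : List (I × A)) (hl : ∀ y ∈ l, y.2 ∈ polyValues₀ ι (X y.1)) :
    ∃ l' : List (I × A), (∀ y ∈ l', y.2 ∈ polyValues₀ ι (X y.1)) ∧
      l'.IsChain (fun y z => y.1 ≠ z.1) ∧ (l'.map Prod.snd).prod = (l.map Prod.snd).prod ∧
      l'.head?.map Prod.fst = l.head?.map Prod.fst ∧
      l'.getLast?.map Prod.fst = l.getLast?.map Prod.fst := by
  induction l with
  | nil => exact ⟨[], by simp⟩
  | cons x t ih =>
    obtain ⟨i, x⟩ := x
    obtain ⟨t', h₁, h₂, h₃, h₄, h₅⟩ := ih fun y hy => hl y (List.mem_cons_of_mem _ hy)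
    have hx : x ∈ polyValues₀ ι (X i) := hl (i, x) List.mem_cons_self
    rcases t' with - | ⟨⟨j, y⟩, t''⟩
    · have ht : t = [] := by
        cases t with
        | nil => rfl
        | cons a t => simp at h₄
      subst ht
      exact ⟨[(i, x)], by simpa using hx, by simp, by simp, by simp, by simp⟩
    · have ht : t ≠ [] := by rintro rfl; simp at h₄
      have hlast : (((i, x) :: t).getLast?).map Prod.fst = t.getLast?.map Prod.fst := by
        cases t with
        | nil => exact absurd rfl ht
        | cons a t => rw [List.getLast?_cons_cons]
      rw [hlast, ← h₅]
      -- Neighbours with equal indices are merged into one factor, which is allowed because the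
      -- polynomials without free term are closed under multiplication.
      by_cases hij : i = j
      · subst hij
        refine ⟨(i, x * y) :: t'', ?_, ?_, ?_, by simp, ?_⟩
        · intro z hz
          rcases List.mem_cons.1 hz with rfl | hz
          · exact mul_mem_polyValues₀ hx (h₁ (i, y) List.mem_cons_self)
          · exact h₁ z (List.mem_cons_of_mem _ hz)
        · cases t'' with
          | nil => simp
          | cons a t'' => simpa using h₂
        · simp [← h₃, mul_assoc]
        · cases t'' with
          | nil => simp
          | cons a t'' => rw [List.getLast?_cons_cons, List.getLast?_cons_cons]
      · refine ⟨(i, x) :: (j, y) :: t'', ?_, ?_, ?_, by simp, ?_⟩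
        · intro z hz
          rcases List.mem_cons.1 hz with rfl | hz
          · exact hx
          · exact h₁ z hz
        · exact List.isChain_cons_cons.2 ⟨hij, h₂⟩
        · simp [← h₃]
        · rw [List.getLast?_cons_cons]

/-- The peak rule of monotone independence without the requirement that consecutive indices be
distinct. -/
theorem MonotoneIndependent.peak {I : Type*} [LinearOrder I] {X : I → A}
    (hX : MonotoneIndependent ι E X) {l₁ l₂ : List (I × A)} {i : I} {x : A}
    (h₁ : ∀ y ∈ l₁, y.2 ∈ polyValues₀ ι (X y.1)) (h₂ : ∀ y ∈ l₂, y.2 ∈ polyValues₀ ι (X y.1))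
    (hx : x ∈ polyValues₀ ι (X i)) (hl₁ : ∀ y ∈ l₁.getLast?, y.1 < i)
    (hl₂ : ∀ y ∈ l₂.head?, y.1 < i) :
    E ((l₁.map Prod.snd).prod * x * (l₂.map Prod.snd).prod) =
      E ((l₁.map Prod.snd).prod * ι (E x) * (l₂.map Prod.snd).prod) := by
  obtain ⟨m₁, a₁, b₁, c₁, -, e₁⟩ := exists_isChain_of_mem_polyValues₀ l₁ h₁
  obtain ⟨m₂, a₂, b₂, c₂, d₂, -⟩ := exists_isChain_of_mem_polyValues₀ l₂ h₂
  have hm₁ := Option.forall_mem_map_fst (P := (· < i)) e₁ hl₁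
  have hm₂ := Option.forall_mem_map_fst (P := (· < i)) d₂ hl₂
  rw [← c₁, ← c₂]
  refine hX m₁ m₂ i x ?_ ?_ hm₁ hm₂
  · intro y hy
    rcases List.mem_append.1 hy with hy | hy
    · exact a₁ y hy
    · rcases List.mem_cons.1 hy with rfl | hy
      · exact hx
      · exact a₂ y hy
  · refine List.isChain_append.2 ⟨b₁, ?_, ?_⟩
    · cases m₂ with
      | nil => simp
      | cons y m₂ => exact List.isChain_cons_cons.2 ⟨(hm₂ y (by simp)).ne', b₂⟩
    · intro y hy z hz
      obtain rfl : (i, x) = z := by simpa using hz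
      exact (hm₁ y hy).ne

/-- The products of values of polynomials without free term, with a coefficient on the left, whose
first index satisfies `F` and whose last index satisfies `L`. -/
def letterProducts {I : Type*} (ι : B →⋆ₐ[ℂ] A) (X : I → A) (F L : I → Prop) : Set A :=
  {a | ∃ (b : B) (l : List (I × A)), (∀ y ∈ l, y.2 ∈ polyValues₀ ι (X y.1)) ∧
    (∀ y ∈ l.head?, F y.1) ∧ (∀ y ∈ l.getLast?, L y.1) ∧ a = ι b * (l.map Prod.snd).prod}

/-- This describes the right neighbour of a peak: multiplying by a partial sum puts a letter with
index in `s` in front, and the leading coefficient `b` is absorbed into it as `X i * ι b`, so that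
no free coefficient separates it from the peak. -/
theorem sum_mul_mem_span_letterProducts {I : Type*} {X : I → A} {F L : I → Prop} {s : Finset I}
    (hF : ∀ i ∈ s, F i) (hL : ∀ i ∈ s, L i) {a : A}
    (ha : a ∈ Submodule.span ℂ (letterProducts ι X (fun _ => True) L)) :
    (∑ i ∈ s, X i) * a ∈ Submodule.span ℂ {a | ∃ l : List (I × A),
      (∀ y ∈ l, y.2 ∈ polyValues₀ ι (X y.1)) ∧ (∀ y ∈ l.head?, F y.1) ∧
      (∀ y ∈ l.getLast?, L y.1) ∧ a = (l.map Prod.snd).prod} := by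
  induction ha using Submodule.span_induction with
  | mem x hx =>
    obtain ⟨b, l, h₁, -, h₃, rfl⟩ := hx
    rw [Finset.sum_mul]
    refine sum_mem fun i hi => Submodule.subset_span ⟨(i, X i * ι b) :: l, ?_, ?_, ?_, ?_⟩
    · intro y hy
      rcases List.mem_cons.1 hy with rfl | hy
      · exact mul_coeff_mem_polyValues₀ _ _
      · exact h₁ y hy
    · simpa using hF i hi
    · cases l with
      | nil => simpa using hL i hi
      | cons a l => rwa [List.getLast?_cons_cons]
    · simp [mul_assoc]
  | zero => rw [mul_zero]; exact zero_mem _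
  | add x y _ _ hx hy => rw [mul_add]; exact add_mem hx hy
  | smul z x _ hx => rw [mul_smul_comm]; exact Submodule.smul_mem _ _ hx

theorem eval_sum_mem_span_letterProducts {I : Type*} {X : I → A} {L : I → Prop} {s : Finset I}
    (hL : ∀ i ∈ s, L i) (p : NCPoly B) :
    NCPoly.eval ι.toAlgHom (∑ i ∈ s, X i) p ∈
      Submodule.span ℂ (letterProducts ι X (fun _ => True) L) := by
  induction p using NCPoly.induction_left with
  | h1 => exact Submodule.subset_span ⟨1, [], by simp⟩
  | hC b q ih =>
    rw [map_mul, NCPoly.eval_coeff]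
    generalize NCPoly.eval ι.toAlgHom (∑ i ∈ s, X i) q = a at ih
    induction ih using Submodule.span_induction with
    | mem x hx =>
      obtain ⟨c, l, h₁, h₂, h₃, rfl⟩ := hx
      refine Submodule.subset_span ⟨b * c, l, h₁, h₂, h₃, ?_⟩
      rw [map_mul, mul_assoc]
      rfl
    | zero => rw [mul_zero]; exact zero_mem _
    | add x y _ _ hx hy => rw [mul_add]; exact add_mem hx hy
    | smul z x _ hx => rw [mul_smul_comm]; exact Submodule.smul_mem _ _ hx
  | hX q ih =>
    rw [map_mul, NCPoly.eval_X]
    refine Submodule.span_mono ?_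
      (sum_mul_mem_span_letterProducts (F := fun _ => True) (fun _ _ => trivial) hL ih)
    rintro _ ⟨l, h₁, h₂, h₃, rfl⟩
    exact ⟨1, l, h₁, h₂, h₃, by simp⟩
  | hadd p q hp hq => rw [map_add]; exact add_mem hp hq

theorem distribution_apply (ι : B →⋆ₐ[ℂ] A) (E : A →ₗ[ℂ] B) (a : A) (p : NCPoly B) :
    distribution ι E a p = E (NCPoly.eval ι.toAlgHom a p) := rfl

theorem mul_mem_noFreeTerm {c : NCPoly B} (hc : c ∈ NCPoly.noFreeTerm B) (q : NCPoly B) :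
    c * q ∈ NCPoly.noFreeTerm B := by
  change NCPoly.eval _ _ _ = 0
  rw [map_mul, show NCPoly.eval (AlgHom.id ℂ B) 0 c = 0 from hc, zero_mul]

theorem X_mem_noFreeTerm : NCPoly.X B ∈ NCPoly.noFreeTerm B := NCPoly.eval_X _ _

theorem eval_zero_eq (q : NCPoly B) :
    NCPoly.eval ι.toAlgHom 0 q = ι (NCPoly.freeTerm q) := by
  induction q using NCPoly.induction_left with
  | h1 => rw [map_one, NCPoly.freeTerm_one, map_one]
  | hC b q ih =>
    rw [map_mul, NCPoly.freeTerm_coeff_mul, map_mul, NCPoly.eval_coeff, ih]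
    rfl
  | hX q ih => rw [map_mul, NCPoly.eval_X, zero_mul, NCPoly.freeTerm_X_mul, map_zero]
  | hadd p q hp hq => rw [map_add, map_add, map_add, hp, hq]

theorem eval_star {a : A} (ha : IsSelfAdjoint a) (p : NCPoly B) :
    NCPoly.eval ι.toAlgHom a (star p) = star (NCPoly.eval ι.toAlgHom a p) := by
  induction p using NCPoly.induction with
  | hC b =>
    rw [NCPoly.star_coeff, NCPoly.eval_coeff, NCPoly.eval_coeff]
    exact map_star ι b
  | hX => rw [NCPoly.star_X, NCPoly.eval_X, ha.star_eq]
  | hadd p q hp hq => rw [star_add, map_add, map_add, hp, hq, star_add]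
  | hmul p q hp hq => rw [star_mul, map_mul, map_mul, hp, hq, star_mul]

theorem isSelfAdjoint_normalizedSum {X : ℕ → A} (hX : ∀ i, IsSelfAdjoint (X i)) (N : ℕ) :
    IsSelfAdjoint (normalizedSum X N) := by
  refine IsSelfAdjoint.smul (Complex.conj_ofReal _) ?_
  rw [isSelfAdjoint_iff, star_sum]
  exact Finset.sum_congr rfl fun i _ => (hX i).star_eq

end peak

/-! ### Moments of partial sums and the central limit theorem. -/

section limit

variable {B A : Type*} [CStarAlgebra B] [PartialOrder B] [CStarAlgebra A]
  {ι : B →⋆ₐ[ℂ] A} {E : A →ₗ[ℂ] B} {X : ℕ → A}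

theorem IsPosCondExp.map_incl_mul (hE : IsPosCondExp ι E) (b : B) (a : A) :
    E (ι b * a) = b * E a := by
  simpa using hE.map_bimodule b 1 a

theorem IsPosCondExp.map_mul_incl (hE : IsPosCondExp ι E) (a : A) (c : B) :
    E (a * ι c) = E a * c := by
  simpa using hE.map_bimodule 1 c a

/-- In an expectation, a polynomial in `X N` without free term that stands between polynomials in
the preceding variables may be replaced by its expectation. -/
theorem MonotoneIndependent.peak_span (hE : IsPosCondExp ι E) (hX : MonotoneIndependent ι E X)
    {N : ℕ} {x : A} (hx : x ∈ polyValues₀ ι (X N)) (p : NCPoly B) {a : A}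
    (ha : a ∈ Submodule.span ℂ {a | ∃ l : List (ℕ × A),
      (∀ y ∈ l, y.2 ∈ polyValues₀ ι (X y.1)) ∧ (∀ y ∈ l.head?, y.1 < N) ∧
      (∀ y ∈ l.getLast?, True) ∧ a = (l.map Prod.snd).prod}) :
    E (NCPoly.eval ι.toAlgHom (∑ i ∈ Finset.range N, X i) p * x * a) =
      E (NCPoly.eval ι.toAlgHom (∑ i ∈ Finset.range N, X i) p * ι (E x) * a) := by
  have hp := eval_sum_mem_span_letterProducts (ι := ι) (X := X) (L := (· < N))
    (s := Finset.range N) (fun i hi => Finset.mem_range.1 hi) p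
  generalize NCPoly.eval ι.toAlgHom (∑ i ∈ Finset.range N, X i) p = c at hp
  induction ha using Submodule.span_induction with
  | mem a ha =>
    obtain ⟨l₂, h₂, hl₂, -, rfl⟩ := ha
    induction hp using Submodule.span_induction with
    | mem c hc =>
      obtain ⟨b, l₁, h₁, -, hl₁, rfl⟩ := hc
      have := hX.peak h₁ h₂ hx hl₁ hl₂
      simp only [mul_assoc, hE.map_incl_mul] at this ⊢
      rw [this]
    | zero => simp only [zero_mul]
    | add x y _ _ hx hy => simp only [add_mul, map_add, hx, hy]
    | smul z x _ hx => simp only [smul_mul_assoc, map_smul, hx]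
  | zero => simp only [mul_zero]
  | add x y _ _ hx hy => simp only [mul_add, map_add, hx, hy]
  | smul z x _ hx => simp only [mul_smul_comm, map_smul, hx]

/-- Integrating out the last variable of a sum of monotone independent variables. -/
theorem expectation_eval_sum_succ (hE : IsPosCondExp ι E) (hX : MonotoneIndependent ι E X)
    {μ : NCPoly B →ₗ[ℂ] B} (hμ : ∀ i, distribution ι E (X i) = μ) (N : ℕ) (q : NCPoly B) :
    (∀ p, E (NCPoly.eval ι.toAlgHom (∑ i ∈ Finset.range N, X i) p *
        NCPoly.eval ι.toAlgHom (∑ i ∈ Finset.range (N + 1), X i) q) =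
      distribution ι E (∑ i ∈ Finset.range N, X i) (p * NCPoly.integrate μ q)) ∧
    ∀ p, ∀ c ∈ NCPoly.noFreeTerm B,
      E (NCPoly.eval ι.toAlgHom (∑ i ∈ Finset.range N, X i) p *
        NCPoly.eval ι.toAlgHom (X N) c *
        NCPoly.eval ι.toAlgHom (∑ i ∈ Finset.range (N + 1), X i) q) =
      distribution ι E (∑ i ∈ Finset.range N, X i) (p * NCPoly.integrateAfter μ q c) := by
  have hμc : ∀ c, E (NCPoly.eval ι.toAlgHom (X N) c) = μ c := fun c => by rw [← hμ N]; rfl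
  have hι : ∀ b, ι b = NCPoly.eval ι.toAlgHom (∑ i ∈ Finset.range N, X i) (NCPoly.coeff B b) :=
    fun b => (NCPoly.eval_coeff _ _ b).symm
  -- Both claims are proved together and for all `p`: retained letters are moved into `p`, and
  -- letters `X N` into the open factor `c`.
  induction q using NCPoly.induction_left with
  | h1 =>
    refine ⟨fun p => ?_, fun p c hc => ?_⟩
    · rw [NCPoly.integrate_one, map_one, mul_one, mul_one, distribution_apply]
    · rw [NCPoly.integrateAfter_one, map_one,
        hX.peak_span hE ⟨c, hc, rfl⟩ p (Submodule.subset_span ⟨[], by simp⟩), hμc, mul_one, hι,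
        ← map_mul, distribution_apply]
  | hC b q ih =>
    refine ⟨fun p => ?_, fun p c hc => ?_⟩
    · rw [NCPoly.integrate_coeff_mul, ← mul_assoc, ← ih.1]
      simp only [map_mul, NCPoly.eval_coeff, mul_assoc]
    · rw [NCPoly.integrateAfter_coeff_mul, ← ih.2 _ _ (mul_mem_noFreeTerm hc _)]
      simp only [map_mul, NCPoly.eval_coeff, mul_assoc]
  | hX q ih =>
    have hT : NCPoly.eval ι.toAlgHom (∑ i ∈ Finset.range (N + 1), X i) (NCPoly.X B * q) =
        (∑ i ∈ Finset.range N, X i) *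
          NCPoly.eval ι.toAlgHom (∑ i ∈ Finset.range (N + 1), X i) q +
        X N * NCPoly.eval ι.toAlgHom (∑ i ∈ Finset.range (N + 1), X i) q := by
      rw [map_mul, NCPoly.eval_X, ← add_mul, ← Finset.sum_range_succ]
    refine ⟨fun p => ?_, fun p c hc => ?_⟩
    · rw [NCPoly.integrate_X_mul, mul_add, map_add, ← ih.2 _ _ X_mem_noFreeTerm, ← mul_assoc,
        ← ih.1, hT, mul_add, map_add]
      simp only [map_mul, NCPoly.eval_X, mul_assoc]
    -- When the next letter is taken from `S_N`, the factor `c(X N)` stands between letters of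
    -- smaller index (or at an end) and is a peak. When it is `X N`, it joins `c`.
    · have ha := sum_mul_mem_span_letterProducts (F := (· < N)) (L := fun _ => True)
        (s := Finset.range N) (fun i hi => Finset.mem_range.1 hi) (fun _ _ => trivial)
        (eval_sum_mem_span_letterProducts (ι := ι) (X := X) (L := fun _ => True)
          (s := Finset.range (N + 1)) (fun _ _ => trivial) q)
      rw [NCPoly.integrateAfter_X_mul, mul_add, map_add, ← ih.2 _ _ (mul_mem_noFreeTerm hc _),
        ← mul_assoc, ← mul_assoc, ← ih.1, hT, mul_add, map_add,
        hX.peak_span hE ⟨c, hc, rfl⟩ p ha, hμc, hι]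
      simp only [map_mul, NCPoly.eval_X, mul_assoc]
      exact add_comm _ _
  | hadd q r hq hr =>
    refine ⟨fun p => ?_, fun p c hc => ?_⟩
    · rw [map_add, map_add, mul_add, mul_add, map_add, map_add, hq.1, hr.1]
    · rw [map_add, NCPoly.integrateAfter_add, mul_add, mul_add, map_add, map_add, hq.2 _ _ hc,
        hr.2 _ _ hc]

theorem distribution_sum_range (hE : IsPosCondExp ι E) (hX : MonotoneIndependent ι E X)
    {μ : NCPoly B →ₗ[ℂ] B} (hμ : ∀ i, distribution ι E (X i) = μ) (N : ℕ) (q : NCPoly B) :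
    distribution ι E (∑ i ∈ Finset.range N, X i) q =
      NCPoly.freeTerm ((NCPoly.integrate μ ^ N) q) := by
  induction N generalizing q with
  | zero =>
    -- The empty sum is zero, and evaluation at zero leaves the free term.
    rw [Finset.range_zero, Finset.sum_empty, distribution_apply, eval_zero_eq, hE.map_incl]
    rfl
  | succ N ih =>
    have h := (expectation_eval_sum_succ hE hX hμ N q).1 1
    rw [map_one, one_mul, one_mul, ih] at h
    rw [distribution_apply, h, pow_succ, Module.End.mul_apply]

theorem distribution_sum_range_eq_sum_choose (hE : IsPosCondExp ι E)
    (hX : MonotoneIndependent ι E X) {μ : NCPoly B →ₗ[ℂ] B}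
    (hμ : ∀ i, distribution ι E (X i) = μ)
    (hμ₁ : ∀ b, μ (NCPoly.X B * NCPoly.coeff B b) = 0) (N : ℕ) {n : ℕ} {q : NCPoly B}
    (hq : q ∈ NCPoly.homogeneous B n) :
    distribution ι E (∑ i ∈ Finset.range N, X i) q =
      ∑ k ∈ Finset.range (n + 1),
        (N.choose k : ℂ) • NCPoly.freeTerm ((NCPoly.integrateSubOne μ ^ k) q) := by
  rw [distribution_sum_range hE hX hμ, NCPoly.integrate_eq_integrateSubOne_add_one,
    (Commute.one_right (NCPoly.integrateSubOne μ)).add_pow]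
  simp only [one_pow, mul_one, LinearMap.sum_apply, map_sum]
  have h : ∀ k, NCPoly.freeTerm
      ((NCPoly.integrateSubOne μ ^ k * ((N.choose k : ℕ) : Module.End ℂ (NCPoly B))) q) =
      (N.choose k : ℂ) • NCPoly.freeTerm ((NCPoly.integrateSubOne μ ^ k) q) := by
    intro k
    rw [Module.End.mul_apply, Module.End.natCast_apply, map_nsmul, map_nsmul,
      Nat.cast_smul_eq_nsmul]
  simp only [h]
  -- The binomial sum over `k ≤ N` is replaced by one whose length does not depend on `N`: the terms
  -- by which the two differ vanish, either because `k > N` or because `D^k q = 0` for `k > n`.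
  rcases le_total N n with hNn | hNn
  · refine Finset.sum_subset (Finset.range_subset_range.2 (by omega)) fun k _ hk => ?_
    rw [Nat.choose_eq_zero_of_lt (by simpa using hk), Nat.cast_zero, zero_smul]
  · refine (Finset.sum_subset (Finset.range_subset_range.2 (by omega)) fun k _ hk => ?_).symm
    have hk : n < k := by simpa using hk
    rw [NCPoly.integrateSubOne_pow_eq_zero hμ₁ (by omega) hq, map_zero, smul_zero]

/-- For `N > 0` the expression factors as `C(N,k) / N^k`, which tends to `1/k!`, times `(1/√N)^(n -
2k)`, which tends to zero unless `n = 2k`. -/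
theorem tendsto_inv_sqrt_pow_mul_choose {n k : ℕ} (h : 2 * k ≤ n) :
    Tendsto (fun N : ℕ => ((1 / Real.sqrt N : ℝ) : ℂ) ^ n * (N.choose k : ℂ)) atTop
      (𝓝 (if n = 2 * k then (k.factorial : ℂ)⁻¹ else 0)) := by
  have h₁ : Tendsto (fun N : ℕ => (N.choose k : ℝ) / (N : ℝ) ^ k) atTop
      (𝓝 ((k.factorial : ℝ)⁻¹)) := by
    have h := (isEquivalent_choose k)
    have h' := (Asymptotics.isEquivalent_iff_tendsto_one ?_).1 h
    · have h'' := h'.mul_const ((k.factorial : ℝ)⁻¹)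
      rw [one_mul] at h''
      refine h''.congr fun N => ?_
      have : (k.factorial : ℝ) ≠ 0 := by positivity
      simp only [Pi.div_apply]
      field_simp
    · filter_upwards [eventually_gt_atTop 0] with N hN
      positivity
  have h₂ : Tendsto (fun N : ℕ => (1 / Real.sqrt N) ^ (n - 2 * k)) atTop
      (𝓝 (if n = 2 * k then 1 else 0)) := by
    have h₀ : Tendsto (fun N : ℕ => 1 / Real.sqrt N) atTop (𝓝 0) := by
      simp only [one_div]
      exact tendsto_inv_atTop_zero.comp
        (Real.tendsto_sqrt_atTop.comp tendsto_natCast_atTop_atTop)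
    split_ifs with hn
    · simp [hn]
    · simpa [show n - 2 * k ≠ 0 by omega] using h₀.pow (n - 2 * k)
  have h₃ : Tendsto (fun N : ℕ => (1 / Real.sqrt N) ^ n * (N.choose k : ℝ)) atTop
      (𝓝 (if n = 2 * k then (k.factorial : ℝ)⁻¹ else 0)) := by
    have := h₁.mul h₂
    rw [mul_ite, mul_one, mul_zero] at this
    refine this.congr' ?_
    filter_upwards [eventually_gt_atTop 0] with N hN
    have hs : Real.sqrt N ≠ 0 := by positivity
    have e : (N : ℝ) ^ k = Real.sqrt N ^ (2 * k) := by
      rw [pow_mul, Real.sq_sqrt (Nat.cast_nonneg N)]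
    rw [e, ← Nat.add_sub_cancel' h, Nat.add_sub_cancel_left, pow_add,
      one_div_pow (Real.sqrt N) (2 * k)]
    ring
  have h₄ := (Complex.continuous_ofReal.tendsto _).comp h₃
  convert h₄ using 2
  · simp
  · split_ifs <;> simp

theorem tendsto_distribution_normalizedSum (hE : IsPosCondExp ι E)
    (hX : MonotoneIndependent ι E X) {η : B →ₗ[ℂ] B} (h₀ : ∀ i, E (X i) = 0)
    (hid : ∀ i j, distribution ι E (X i) = distribution ι E (X j))
    (hη : ∀ i b, η b = E (X i * ι b * X i)) (p : NCPoly B) :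
    Tendsto (fun N : ℕ => distribution ι E (normalizedSum X N) p) atTop
      (𝓝 (NCPoly.arcsine η p)) := by
  have hμ : ∀ i, distribution ι E (X i) = distribution ι E (X 0) := fun i => hid i 0
  have hμ₁ : ∀ b, distribution ι E (X 0) (NCPoly.X B * NCPoly.coeff B b) = 0 := fun b => by
    rw [distribution_apply, map_mul (NCPoly.eval _ _), NCPoly.eval_X, NCPoly.eval_coeff]
    exact (hE.map_mul_incl _ _).trans (by rw [h₀, zero_mul])
  have hμ₂ : ∀ b c, distribution ι E (X 0)
      (NCPoly.X B * NCPoly.coeff B b * (NCPoly.X B * NCPoly.coeff B c)) = η b * c := fun b c => by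
    rw [distribution_apply]
    simp only [map_mul, NCPoly.eval_X, NCPoly.eval_coeff]
    rw [← mul_assoc, hη 0, ← hE.map_mul_incl]
    rfl
  induction p using NCPoly.induction_homogeneous with
  | hH n p hp =>
    have e : ∀ N : ℕ, distribution ι E (normalizedSum X N) p = ∑ k ∈ Finset.range (n + 1),
        (((1 / Real.sqrt N : ℝ) : ℂ) ^ n * (N.choose k : ℂ)) •
          NCPoly.freeTerm ((NCPoly.integrateSubOne (distribution ι E (X 0)) ^ k) p) := by
      intro N
      rw [distribution_apply, normalizedSum, NCPoly.eval_smul_of_mem_homogeneous _ _ _ hp, map_smul,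
        ← distribution_apply, distribution_sum_range_eq_sum_choose hE hX hμ hμ₁ N hp,
        Finset.smul_sum]
      simp only [smul_smul]
    simp only [e]
    -- The limit law is put in the form of the termwise limit; the only term with nonzero weight is
    -- the one where powers of `D` and of `contract η` agree.
    have hlim : NCPoly.arcsine η p = ∑ k ∈ Finset.range (n + 1),
        (if n = 2 * k then (k.factorial : ℂ)⁻¹ else 0) •
          NCPoly.freeTerm ((NCPoly.integrateSubOne (distribution ι E (X 0)) ^ k) p) := by
      simp only [ite_smul, zero_smul]
      rcases Nat.even_or_odd n with hn | hn
      · obtain ⟨k, hk⟩ := even_iff_exists_two_mul.1 hn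
        rw [Finset.sum_eq_single k, if_pos hk,
          NCPoly.integrateSubOne_pow_eq_contract_pow hμ₁ hμ₂ hk hp, NCPoly.arcsine_of_even η hk hp]
        · intro j _ hj
          rw [if_neg (by omega)]
        · intro hk'
          exact absurd (Finset.mem_range.2 (by omega)) hk'
      · rw [NCPoly.arcsine_of_odd η hn hp]
        refine (Finset.sum_eq_zero fun k _ => if_neg ?_).symm
        rintro rfl
        grind
    rw [hlim]
    refine tendsto_finsetSum _ fun k _ => ?_
    by_cases h : 2 * k ≤ n
    · exact (tendsto_inv_sqrt_pow_mul_choose h).smul_const _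
    · rw [NCPoly.integrateSubOne_pow_eq_zero hμ₁ (by omega) hp, map_zero]
      simp
  | hadd p q hp hq =>
    simp only [map_add]
    exact hp.add hq

/-- Self-adjointness of `a` makes evaluation at `a` a `*`-homomorphism, so positivity of `E` is
inherited. -/
theorem isPosCondExp_distribution (hE : IsPosCondExp ι E) {a : A} (ha : IsSelfAdjoint a) :
    IsPosCondExp (NCPoly.C B) (distribution ι E a) where
  map_incl b := by
    rw [distribution_apply]
    exact (congrArg E (NCPoly.eval_coeff _ _ b)).trans (hE.map_incl b)
  map_bimodule b c p := by
    rw [distribution_apply, map_mul (NCPoly.eval _ _), map_mul (NCPoly.eval _ _)]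
    have h : ∀ b, NCPoly.eval ι.toAlgHom a (NCPoly.C B b) = ι b := NCPoly.eval_coeff _ _
    rw [h, h, hE.map_bimodule, distribution_apply]
  nonneg p := by
    rw [distribution_apply, map_mul (NCPoly.eval _ _), eval_star ha]
    exact hE.nonneg _

end limit

section positivity

variable {B : Type*} [CStarAlgebra B] [PartialOrder B] [StarOrderedRing B]

/-- The positive cone of `B` is norm closed, and multiplication by fixed elements is continuous. -/
theorem isPosCondExp_of_tendsto {μ : ℕ → NCPoly B →ₗ[ℂ] B} {ν : NCPoly B →ₗ[ℂ] B}
    (hμ : ∀ N, IsPosCondExp (NCPoly.C B) (μ N))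
    (h : ∀ p, Tendsto (fun N => μ N p) atTop (𝓝 (ν p))) : IsPosCondExp (NCPoly.C B) ν where
  map_incl b := by
    refine tendsto_nhds_unique (h _) ?_
    simp only [(hμ _).map_incl]
    exact tendsto_const_nhds
  map_bimodule b c p := by
    refine tendsto_nhds_unique (h _) ?_
    simp only [(hμ _).map_bimodule]
    exact ((h p).const_mul b).mul_const c
  nonneg p := ge_of_tendsto' (h _) fun N => (hμ N).nonneg p

end positivity

end

/-! ### Recursion for the moments of the limit law with matrix coefficients. -/

noncomputable section

/-! ### Contraction moments of lists of coefficients -/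

section lists

variable {R M N : Type*} [AddCommMonoid M] [AddCommMonoid N]

/-- The sum of `F u x v` over all decompositions `u ++ x :: v` of a list. -/
def sumSplit : (List R → R → List R → M) → List R → M
  | _, [] => 0
  | F, c :: t => F [] c t + sumSplit (fun u x v => F (c :: u) x v) t

theorem sumSplit_add (F G : List R → R → List R → M) (l : List R) :
    sumSplit (fun u x v => F u x v + G u x v) l = sumSplit F l + sumSplit G l := by
  induction l generalizing F G with
  | nil => simp [sumSplit]
  | cons c t ih => simp only [sumSplit, ih]; abel

theorem map_sumSplit (f : M →+ N) (F : List R → R → List R → M) (l : List R) :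
    f (sumSplit F l) = sumSplit (fun u x v => f (F u x v)) l := by
  induction l generalizing F with
  | nil => simp [sumSplit]
  | cons c t ih => simp only [sumSplit, map_add, ih]

theorem sumSplit_zero (l : List R) : sumSplit (fun _ _ _ => (0 : M)) l = 0 := by
  induction l with
  | nil => rfl
  | cons c t ih => simp only [sumSplit, ih, add_zero]

theorem sumSplit_replicate (F : List R → R → List R → M) (b : R) (n : ℕ) :
    sumSplit F (List.replicate n b) =
      ∑ s ∈ Finset.range n, F (List.replicate s b) b (List.replicate (n - 1 - s) b) := by
  induction n generalizing F with
  | zero => simp [sumSplit]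
  | succ n ih =>
    rw [List.replicate_succ, sumSplit, ih, Finset.sum_range_succ', add_comm]
    refine congrArg₂ _ (Finset.sum_congr rfl fun s _ => ?_) (by simp)
    rw [List.replicate_succ, show n + 1 - 1 - (s + 1) = n - 1 - s by omega]

variable [Ring R]

/-- The term of `sumContract` that contracts the first two letters. -/
def headContract (η : R → R) (G : R → List R → M) (c : R) : List R → M
  | [] => 0
  | d :: t => G (η c * d) t

/-- The sum of `G b₀ l'` over all words `b₀ 𝒳 l'₁ 𝒳 l'₂ ⋯` obtained from the word
`𝒳 l₁ 𝒳 l₂ ⋯` of a list `l` by contracting an adjacent pair `𝒳 b 𝒳` to `η b`. -/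
def sumContract (η : R → R) : (R → List R → M) → List R → M
  | _, [] => 0
  | G, c :: t => headContract η G c t + sumContract η (fun b l => G 1 ((c * b) :: l)) t

theorem headContract_add (η : R → R) (F G : R → List R → M) (c : R) (l : List R) :
    headContract η (fun b l => F b l + G b l) c l =
      headContract η F c l + headContract η G c l := by
  cases l <;> simp [headContract]

theorem sumContract_add (η : R → R) (F G : R → List R → M) (l : List R) :
    sumContract η (fun b l => F b l + G b l) l = sumContract η F l + sumContract η G l := by
  induction l generalizing F G with
  | nil => simp [sumContract]
  | cons c t ih => simp only [sumContract, ih, headContract_add]; abel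

theorem map_sumContract (η : R → R) (f : M →+ N) (G : R → List R → M) (l : List R) :
    f (sumContract η G l) = sumContract η (fun b l => f (G b l)) l := by
  induction l generalizing G with
  | nil => simp [sumContract]
  | cons c t ih =>
    simp only [sumContract, map_add, ih]
    congr 1
    cases t <;> simp [headContract]

theorem sumContract_eq_zero (η : R → R) {G : R → List R → M} {l : List R}
    (h : ∀ b l', l'.length + 2 = l.length → G b l' = 0) : sumContract η G l = 0 := by
  induction l generalizing G with
  | nil => rfl
  | cons c t ih =>
    rw [sumContract, ih fun b l' hl => h _ _ (by simpa using hl), add_zero]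
    cases t with
    | nil => rfl
    | cons d t => exact h _ _ (by simp)

theorem sumContract_sum (η : R → R) {κ : Type*} (s : Finset κ) (F : κ → R → List R → M)
    (l : List R) :
    sumContract η (fun b l => ∑ k ∈ s, F k b l) l = ∑ k ∈ s, sumContract η (F k) l := by
  induction s using Finset.cons_induction with
  | empty => simpa using sumContract_eq_zero η fun _ _ _ => rfl
  | cons a s ha ih => simp only [Finset.sum_cons, sumContract_add, ih]

theorem headContract_sumSplit (η : R → R) (F : R → List R → R → List R → M) (c : R)
    (t : List R) :
    headContract η (fun b => sumSplit (F b)) c t =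
      sumSplit (fun u x v => headContract η (fun b u' => F b u' x v) c u) t := by
  cases t with
  | nil => rfl
  | cons d t => simp only [headContract, sumSplit, zero_add]

/-- A contraction of a word followed by a choice of a letter amounts to the choice of a letter
followed by a contraction to its left or to its right. -/
theorem sumContract_sumSplit (η : R → R) (F : R → List R → R → List R → M) (l : List R) :
    sumContract η (fun b => sumSplit (F b)) l =
      sumSplit (fun u x v => sumContract η (fun b u' => F b u' x v) u +
        sumContract η (fun b v' => F 1 u (x * b) v') v) l := by
  -- A letter is an occurrence of `𝒳` together with the coefficient on its right. A contraction to
  -- the right of the chosen letter `x` therefore leaves its leading coefficient `b` inside `x`,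
  -- which becomes `x * b`.
  induction l generalizing F with
  | nil => rfl
  | cons c t ih =>
    simp only [sumContract, sumSplit, headContract_sumSplit, sumContract_add, zero_add]
    rw [ih (fun b u x v => F 1 ((c * b) :: u) x v), mul_one]
    simp only [sumSplit_add]
    abel

variable [Algebra ℂ R]

/-- The contribution of the `k`-fold contractions to the moment of the word of a list. -/
def contractMoment (η : R →ₗ[ℂ] R) : ℕ → List R → R
  | 0, [] => 1
  | 0, _ :: _ => 0
  | k + 1, l => ((k : ℂ) + 1)⁻¹ • sumContract η (fun b l' => b * contractMoment η k l') l

variable (η : R →ₗ[ℂ] R)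

theorem smul_contractMoment_succ (k : ℕ) (l : List R) :
    ((k : ℂ) + 1) • contractMoment η (k + 1) l =
      sumContract η (fun b l' => b * contractMoment η k l') l := by
  rw [contractMoment, smul_smul, mul_inv_cancel₀ (Nat.cast_add_one_ne_zero k), one_smul]

theorem contractMoment_eq_zero {k : ℕ} {l : List R} (h : l.length ≠ 2 * k) :
    contractMoment η k l = 0 := by
  induction k generalizing l with
  | zero =>
    cases l with
    | nil => simp at h
    | cons b l => rfl
  | succ k ih =>
    rw [contractMoment, sumContract_eq_zero, smul_zero]
    intro b l' hl
    rw [ih (by omega), mul_zero]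

/-- Without contractions only the empty word has a nonzero moment, so only the split with empty left
part remains. `headContract` serves here merely as a case distinction on the list. -/
theorem sumSplit_contractMoment_zero (f : R → R → List R → R) (hf : ∀ x v, f 0 x v = 0)
    (l : List R) :
    sumSplit (fun u x v => f (contractMoment η 0 u) x v) l =
      headContract (fun _ => 1) (fun d t => f 1 d t) 1 l := by
  cases l with
  | nil => rfl
  | cons c t =>
    simp only [sumSplit, contractMoment, hf, sumSplit_zero, headContract, add_zero, one_mul]

/-- Decomposition of a moment according to the letter contracted with the first one. -/
theorem contractMoment_succ_cons (k : ℕ) (b : R) (l : List R) :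
    contractMoment η (k + 1) (b :: l) =
      sumSplit (fun u x v => ∑ ij ∈ Finset.HasAntidiagonal.antidiagonal k, ((ij.1 : ℂ) + 1)⁻¹ •
        (η (b * contractMoment η ij.1 u) * x * contractMoment η ij.2 v)) l := by
  have hk : ((k : ℂ) + 1) ≠ 0 := Nat.cast_add_one_ne_zero k
  -- After multiplication by `k + 1` the left side is a sum over the pair contracted first: either
  -- the first letter with its neighbour, or a pair not involving the first letter, in which case
  -- induction applies to the shorter word.
  refine (smul_right_inj hk).1 ?_
  rw [smul_contractMoment_succ, sumContract]
  have hhead : headContract η (fun b l' => b * contractMoment η k l') b l =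
      sumSplit (fun u x v => η (b * contractMoment η 0 u) * x * contractMoment η k v) l := by
    rw [sumSplit_contractMoment_zero η (fun c x v => η (b * c) * x * contractMoment η k v)
      (by simp)]
    cases l <;> simp [headContract]
  have hsmul := map_sumSplit (DistribSMul.toAddMonoidHom R ((k : ℂ) + 1))
    (fun u x v => ∑ ij ∈ Finset.HasAntidiagonal.antidiagonal k, ((ij.1 : ℂ) + 1)⁻¹ •
        (η (b * contractMoment η ij.1 u) * x * contractMoment η ij.2 v)) l
  simp only [DistribSMul.toAddMonoidHom_apply] at hsmul
  rw [hsmul, hhead]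
  cases k with
  | zero =>
    rw [sumContract_eq_zero _ (fun c l' _ => by rw [contractMoment, mul_zero]), add_zero]
    simp
  | succ k =>
    simp only [one_mul, contractMoment_succ_cons k]
    rw [sumContract_sumSplit η (fun c u x v => ∑ ij ∈ Finset.HasAntidiagonal.antidiagonal k,
      ((ij.1 : ℂ) + 1)⁻¹ •
        (η (b * c * contractMoment η ij.1 u) * x * contractMoment η ij.2 v)), ← sumSplit_add]
    refine congrArg (fun F => sumSplit F l) (funext fun u => funext fun x => funext fun v => ?_)
    -- Contractions under the arc from the first letter to `x`: the factor `i + 1` they produce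
    -- cancels the weight.
    have e₁ : ∀ i j : ℕ, sumContract η (fun c u' => ((i : ℂ) + 1)⁻¹ •
        (η (b * c * contractMoment η i u') * x * contractMoment η j v)) u =
        η (b * contractMoment η (i + 1) u) * x * contractMoment η j v := by
      intro i j
      have := map_sumContract η (((i : ℂ) + 1)⁻¹ • (LinearMap.mulRight ℂ (contractMoment η j v) ∘ₗ
        LinearMap.mulRight ℂ x ∘ₗ η ∘ₗ LinearMap.mulLeft ℂ b)).toAddMonoidHom
        (fun c u' => c * contractMoment η i u') u
      rw [← smul_contractMoment_succ] at this
      simp only [LinearMap.toAddMonoidHom_coe, LinearMap.smul_apply, LinearMap.comp_apply,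
        LinearMap.mulLeft_apply, LinearMap.mulRight_apply, map_smul, smul_smul,
        mul_inv_cancel₀ (Nat.cast_add_one_ne_zero (R := ℂ) i), one_smul, ← mul_assoc] at this
      exact this.symm
    -- Contractions to the right of `x`: the factor `j + 1` stays, beside the weight `1/(i+1)`.
    have e₂ : ∀ i j : ℕ, sumContract η (fun c v' => ((i : ℂ) + 1)⁻¹ •
        (η (b * 1 * contractMoment η i u) * (x * c) * contractMoment η j v')) v =
        (((j : ℂ) + 1) * ((i : ℂ) + 1)⁻¹) •
          (η (b * contractMoment η i u) * x * contractMoment η (j + 1) v) := by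
      intro i j
      have := map_sumContract η (((i : ℂ) + 1)⁻¹ •
        LinearMap.mulLeft ℂ (η (b * contractMoment η i u) * x)).toAddMonoidHom
        (fun c v' => c * contractMoment η j v') v
      rw [← smul_contractMoment_succ] at this
      simp only [LinearMap.toAddMonoidHom_coe, LinearMap.smul_apply,
        LinearMap.mulLeft_apply, mul_smul_comm, smul_smul] at this
      rw [mul_comm, this]
      simp only [mul_one, mul_assoc]
    simp only [sumContract_sum, e₁, e₂]
    rw [← add_assoc, ← Finset.Nat.sum_antidiagonal_succ
      (f := fun ij => η (b * contractMoment η ij.1 u) * x * contractMoment η ij.2 v)]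
    have e₃ := Finset.Nat.sum_antidiagonal_succ' (n := k)
      (f := fun ij : ℕ × ℕ => ((ij.2 : ℂ) * ((ij.1 : ℂ) + 1)⁻¹) •
        (η (b * contractMoment η ij.1 u) * x * contractMoment η ij.2 v))
    simp only [Nat.cast_zero, zero_mul, zero_smul, zero_add, Nat.cast_add, Nat.cast_one] at e₃
    rw [← e₃, ← Finset.sum_add_distrib, Finset.smul_sum]
    -- The coefficients match: the head term and the left contractions give `1`, the right
    -- contractions `j/(i+1)`, and the total is `(i+1+j)/(i+1)`, where `i + j` is the present `k +
    -- 1`.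
    refine Finset.sum_congr rfl fun ij hij => ?_
    have hi : ((ij.1 : ℂ) + 1) ≠ 0 := Nat.cast_add_one_ne_zero _
    have hsum : ((ij.1 : ℂ) + (ij.2 : ℂ)) = k + 1 := by
      exact_mod_cast Finset.HasAntidiagonal.mem_antidiagonal.1 hij
    nth_rewrite 1 [← one_smul ℂ (η (b * contractMoment η ij.1 u) * x * contractMoment η ij.2 v)]
    rw [← add_smul, smul_smul]
    congr 1
    field_simp
    push_cast
    linear_combination hsum

/-- A moment with `i` contractions vanishes unless its word has length `2i`, so the position of the
partner of the first letter is determined by `i`. -/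
theorem contractMoment_replicate_succ (k : ℕ) (b : R) :
    contractMoment η (k + 1) (List.replicate (2 * (k + 1)) b) =
      ∑ ij ∈ Finset.HasAntidiagonal.antidiagonal k, ((ij.1 : ℂ) + 1)⁻¹ •
        (η (b * contractMoment η ij.1 (List.replicate (2 * ij.1) b)) * b *
          contractMoment η ij.2 (List.replicate (2 * ij.2) b)) := by
  rw [show 2 * (k + 1) = (2 * k + 1) + 1 by ring, List.replicate_succ, contractMoment_succ_cons,
    sumSplit_replicate, Finset.sum_comm]
  refine Finset.sum_congr rfl fun ij hij => ?_
  have hij := Finset.HasAntidiagonal.mem_antidiagonal.1 hij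
  rw [Finset.sum_eq_single (2 * ij.1), show 2 * k + 1 - 1 - 2 * ij.1 = 2 * ij.2 by omega]
  · intro s _ hs
    rw [contractMoment_eq_zero η (l := List.replicate s b) (by simpa using hs)]
    simp
  · intro h
    exact absurd (Finset.mem_range.2 (by omega)) h

end lists

/-! ### Matrices of polynomials -/

section matrices

open NCPoly

variable {B : Type*} [Ring B] [Algebra ℂ B] {m : ℕ}

/-- The monomial `𝒳 β₁ 𝒳 β₂ ⋯ 𝒳 βₙ` with matrix coefficients. -/
def matMono : List (Matrix (Fin m) (Fin m) B) → Matrix (Fin m) (Fin m) (NCPoly B)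
  | [] => 1
  | β :: L => Matrix.scalar (Fin m) (X B) * (β.map (coeff B) * matMono L)

theorem scalar_X_mul_apply (P : Matrix (Fin m) (Fin m) (NCPoly B)) (i j : Fin m) :
    (Matrix.scalar (Fin m) (X B) * P) i j = X B * P i j := by
  simp [Matrix.scalar_apply, Matrix.diagonal_mul]

theorem map_coeff_mul_apply (β : Matrix (Fin m) (Fin m) B)
    (P : Matrix (Fin m) (Fin m) (NCPoly B)) (i j : Fin m) :
    (β.map (coeff B) * P) i j = ∑ s, coeff B (β i s) * P s j := by
  simp [Matrix.mul_apply]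

theorem map_coeff_mul (β γ : Matrix (Fin m) (Fin m) B) :
    (β * γ).map (coeff B) = β.map (coeff B) * γ.map (coeff B) :=
  Matrix.map_mul

theorem map_coeff_one : (1 : Matrix (Fin m) (Fin m) B).map (coeff B) = 1 := by
  ext i j
  by_cases h : i = j <;> simp [Matrix.one_apply, h]

theorem matMono_apply_mem (L : List (Matrix (Fin m) (Fin m) B)) (i j : Fin m) :
    matMono L i j ∈ homogeneous B L.length := by
  induction L generalizing i j with
  | nil =>
    rw [matMono, Matrix.one_apply]
    split_ifs
    · exact mono_mem (l := []) (by simp)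
    · exact zero_mem _
  | cons β L ih =>
    rw [matMono, scalar_X_mul_apply, map_coeff_mul_apply]
    exact X_mul_mem_homogeneous (by simp) (sum_mem fun s _ => coeff_mul_mem (ih s j) _)

/-- The entrywise application of a linear map, as an additive map. -/
def entrywise {P Q : Type*} [AddCommMonoid P] [Module ℂ P] [AddCommMonoid Q] [Module ℂ Q]
    (f : P →ₗ[ℂ] Q) : Matrix (Fin m) (Fin m) P →+ Matrix (Fin m) (Fin m) Q :=
  f.toAddMonoidHom.mapMatrix

theorem entrywise_apply {P Q : Type*} [AddCommMonoid P] [Module ℂ P] [AddCommMonoid Q] [Module ℂ Q]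
    (f : P →ₗ[ℂ] Q) (M : Matrix (Fin m) (Fin m) P) (i j : Fin m) :
    entrywise f M i j = f (M i j) := rfl

theorem entrywise_map_coeff_mul (f : NCPoly B →ₗ[ℂ] NCPoly B)
    (hf : ∀ b q, f (coeff B b * q) = coeff B b * f q) (β : Matrix (Fin m) (Fin m) B)
    (P : Matrix (Fin m) (Fin m) (NCPoly B)) :
    entrywise f (β.map (coeff B) * P) = β.map (coeff B) * entrywise f P := by
  ext i j
  simp only [entrywise_apply, map_coeff_mul_apply, map_sum, hf]

theorem contract_pow_coeff_mul (η : B →ₗ[ℂ] B) (k : ℕ) (b : B) (q : NCPoly B) :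
    (contract η ^ k) (coeff B b * q) = coeff B b * (contract η ^ k) q := by
  induction k with
  | zero => rfl
  | succ k ih =>
    rw [pow_succ', Module.End.mul_apply, ih, contract_coeff_mul, Module.End.mul_apply]

/-- Each entry of a matrix word is a sum of scalar words, and `η` of an entry of `β` is an entry of
`η.mapMatrix β`. General lists are needed because a contraction of a constant word is no longer
constant. -/
theorem entrywise_contract_matMono (η : B →ₗ[ℂ] B) (L : List (Matrix (Fin m) (Fin m) B)) :
    entrywise (contract η) (matMono L) =
      sumContract η.mapMatrix (fun β L' => β.map (coeff B) * matMono L') L := by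
  induction L with
  | nil =>
    ext i j
    rw [entrywise_apply, matMono, Matrix.one_apply]
    split_ifs
    · exact contract_one η
    · exact map_zero _
  | cons β L ih =>
    have e : ∀ P : Matrix (Fin m) (Fin m) (NCPoly B),
        ((AddMonoidHom.mulLeft (Matrix.scalar (Fin m) (X B))).comp
          (AddMonoidHom.mulLeft (β.map (coeff B)))) P =
        Matrix.scalar (Fin m) (X B) * (β.map (coeff B) * P) := fun _ => rfl
    have h := map_sumContract η.mapMatrix
      ((AddMonoidHom.mulLeft (Matrix.scalar (Fin m) (X B))).comp
        (AddMonoidHom.mulLeft (β.map (coeff B))))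
      (fun β L' => β.map (coeff B) * matMono L') L
    rw [← ih] at h
    simp only [e, ← mul_assoc (β.map (coeff B)), ← map_coeff_mul] at h
    rw [sumContract]
    simp only [map_coeff_one, one_mul, matMono]
    rw [← h]
    cases L with
    | nil =>
      ext i j
      have e₀ : entrywise (contract η) (matMono ([] : List (Matrix (Fin m) (Fin m) B))) = 0 := ih
      rw [e₀, mul_zero, mul_zero, headContract, add_zero, matMono, mul_one, entrywise_apply,
        scalar_X_mul_apply, Matrix.map_apply, contract_X_mul_coeff]
      rfl
    | cons γ L =>
      ext i j
      rw [headContract, map_coeff_mul, mul_assoc, Matrix.add_apply, scalar_X_mul_apply,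
        map_coeff_mul_apply, map_coeff_mul_apply, entrywise_apply, scalar_X_mul_apply,
        map_coeff_mul_apply, Finset.mul_sum, Finset.mul_sum, map_sum, ← Finset.sum_add_distrib]
      refine Finset.sum_congr rfl fun s _ => ?_
      rw [entrywise_apply, matMono, scalar_X_mul_apply, contract_X_mul_coeff_mul_X_mul, add_comm]
      rfl

/-- The factors `1/(k+1)` in the recursive definition of `contractMoment` accumulate to the `1/k!`
of the exponential. -/
theorem entrywise_freeTerm_contract_pow_matMono (η : B →ₗ[ℂ] B) (k : ℕ)
    (L : List (Matrix (Fin m) (Fin m) B)) :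
    entrywise freeTerm (entrywise (contract η ^ k) (matMono L)) =
      (k.factorial : ℂ) • contractMoment η.mapMatrix k L := by
  induction k generalizing L with
  | zero =>
    ext i j
    rw [entrywise_apply, entrywise_apply, pow_zero, Module.End.one_apply, Nat.factorial_zero,
      Nat.cast_one, one_smul]
    cases L with
    | nil =>
      rw [matMono, contractMoment, Matrix.one_apply, Matrix.one_apply]
      split_ifs
      · exact freeTerm_one
      · exact map_zero _
    | cons β L =>
      rw [matMono, scalar_X_mul_apply, freeTerm_X_mul, contractMoment]
      rfl
  | succ k ih =>
    have e : entrywise (contract η ^ (k + 1)) (matMono L) =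
        entrywise (contract η ^ k) (entrywise (contract η) (matMono L)) := by
      ext i j
      rw [entrywise_apply, pow_succ, Module.End.mul_apply]
      rfl
    have h : ∀ (β : Matrix (Fin m) (Fin m) B) (P : Matrix (Fin m) (Fin m) (NCPoly B)),
        entrywise freeTerm (β.map (coeff B) * P) = β * entrywise freeTerm P := by
      intro β P
      ext i j
      rw [entrywise_apply, map_coeff_mul_apply, map_sum, Matrix.mul_apply]
      exact Finset.sum_congr rfl fun s _ => freeTerm_coeff_mul _ _
    rw [e, entrywise_contract_matMono, map_sumContract, map_sumContract]
    simp only [entrywise_map_coeff_mul _ (contract_pow_coeff_mul η k), h, ih, mul_smul_comm]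
    have h' := map_sumContract η.mapMatrix
      (DistribSMul.toAddMonoidHom (Matrix (Fin m) (Fin m) B) (k.factorial : ℂ))
      (fun β L' => β * contractMoment η.mapMatrix k L') L
    simp only [DistribSMul.toAddMonoidHom_apply] at h'
    rw [← h', ← smul_contractMoment_succ, smul_smul, Nat.factorial_succ]
    push_cast
    rw [mul_comm]

theorem entrywise_arcsine_matMono_of_even (η : B →ₗ[ℂ] B) {k : ℕ}
    {L : List (Matrix (Fin m) (Fin m) B)} (h : L.length = 2 * k) :
    entrywise (arcsine η) (matMono L) = contractMoment η.mapMatrix k L := by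
  have hk : (k.factorial : ℂ) ≠ 0 := Nat.cast_ne_zero.2 k.factorial_ne_zero
  ext i j
  rw [entrywise_apply, arcsine_of_even η h (matMono_apply_mem L i j)]
  have := congrFun (congrFun (entrywise_freeTerm_contract_pow_matMono η k L) i) j
  rw [entrywise_apply, entrywise_apply] at this
  rw [this, Matrix.smul_apply, smul_smul, inv_mul_cancel₀ hk, one_smul]

theorem entrywise_arcsine_matMono_of_odd (η : B →ₗ[ℂ] B)
    {L : List (Matrix (Fin m) (Fin m) B)} (h : Odd L.length) :
    entrywise (arcsine η) (matMono L) = 0 := by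
  ext i j
  rw [entrywise_apply, arcsine_of_odd η h (matMono_apply_mem L i j)]
  rfl

end matrices

theorem matX_pow {B : Type*} [CStarAlgebra B] {m : ℕ} (b : Matrix (Fin m) (Fin m) B) (n : ℕ) :
    matX b ^ n = matMono (List.replicate n b) := by
  induction n with
  | zero => rfl
  | succ n ih =>
    rw [pow_succ', ih, List.replicate_succ, matMono, matX, mul_assoc]
    rfl

end

noncomputable section

/-! ### Non-crossing pair partitions and binary trees -/

namespace NC2

theorem blocks_injective {n : ℕ} : Function.Injective (blocks (n := n)) := fun _ _ h =>
  Subtype.ext (Finpartition.ext h)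

theorem blocks_nest {n : ℕ} (γ : NC2 n) :
    γ.nest.blocks = insert {1, n + 2} (shift 1 γ.blocks) := rfl

theorem blocks_oplus {n m : ℕ} (γ₁ : NC2 n) (γ₂ : NC2 m) :
    (γ₁.oplus γ₂).blocks = γ₁.blocks ∪ shift n γ₂.blocks := rfl

theorem two_mul_numBlocks {n : ℕ} (γ : NC2 n) : 2 * γ.numBlocks = n := by
  have h := γ.1.sum_card_parts
  rw [Finset.sum_congr rfl γ.2.2, Finset.sum_const, smul_eq_mul, Nat.card_Icc] at h
  rw [numBlocks, blocks]
  omega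

theorem nonempty_of_mem_blocks {n : ℕ} (γ : NC2 n) {P : Finset ℕ} (hP : P ∈ γ.blocks) :
    P.Nonempty :=
  Finset.card_pos.1 (by rw [γ.blocks_card hP]; norm_num)

theorem blocks_eq_empty (γ : NC2 0) : γ.blocks = ∅ := by
  have h := γ.two_mul_numBlocks
  exact Finset.card_eq_zero.1 (by rw [← numBlocks]; omega)

theorem shift_injective (s : ℕ) : Function.Injective (shift s) :=
  Finset.image_injective (Finset.image_injective (add_left_injective s))

theorem shift_empty (s : ℕ) : shift s ∅ = ∅ := rfl

theorem shift_zero (F : Finset (Finset ℕ)) : shift 0 F = F := by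
  simp [shift]

theorem shift_union (s : ℕ) (F G : Finset (Finset ℕ)) : shift s (F ∪ G) = shift s F ∪ shift s G :=
  Finset.image_union _ _

theorem shift_shift (s t : ℕ) (F : Finset (Finset ℕ)) : shift s (shift t F) = shift (t + s) F := by
  simp only [shift, Finset.image_image]
  congr 1
  funext P
  simp only [Function.comp_apply, Finset.image_image]
  congr 1
  funext a
  simp [add_assoc]

/-- The empty partition. -/
def empty : NC2 0 :=
  ofBlocks ∅ (by simp) (by simp) (by simp) (by simp) (by simp)

/-- The restriction of a partition to an interval that is a union of blocks, translated to the
origin. -/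
theorem exists_restrict {n : ℕ} (γ : NC2 n) (s m : ℕ) (hm : s + m ≤ n)
    (h : ∀ P ∈ γ.blocks, ∀ a ∈ P, s < a → a ≤ s + m → ∀ c ∈ P, s < c ∧ c ≤ s + m) :
    ∃ γ' : NC2 m, ∀ P, P ∈ shift s γ'.blocks ↔ P ∈ γ.blocks ∧ ∀ a ∈ P, s < a ∧ a ≤ s + m := by
  have hinj : Function.Injective (Finset.image (· + s)) :=
    Finset.image_injective (add_left_injective s)
  have hex : ∀ P ∈ γ.blocks, (∀ a ∈ P, s < a ∧ a ≤ s + m) →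
      ∃ Q ⊆ Finset.Icc 1 m, Q.image (· + s) = P := by
    intro P _ hP
    refine ⟨(Finset.Icc 1 m).filter (· + s ∈ P), Finset.filter_subset _ _, ?_⟩
    ext a
    simp only [Finset.mem_image, Finset.mem_filter, Finset.mem_Icc]
    constructor
    · rintro ⟨c, ⟨-, hc⟩, rfl⟩
      exact hc
    · intro ha
      have := hP a ha
      exact ⟨a - s, ⟨by omega, by rwa [Nat.sub_add_cancel (by omega)]⟩, by omega⟩
  have hmem : ∀ Q, Q ∈ (Finset.Icc 1 m).powerset.filter (fun Q => Q.image (· + s) ∈ γ.blocks) ↔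
      Q ⊆ Finset.Icc 1 m ∧ Q.image (· + s) ∈ γ.blocks := fun Q => by
    rw [Finset.mem_filter, Finset.mem_powerset]
  refine ⟨ofBlocks ((Finset.Icc 1 m).powerset.filter (fun Q => Q.image (· + s) ∈ γ.blocks))
    (fun P hP => ((hmem P).1 hP).1) ?_ ?_ ?_ ?_, fun P => ?_⟩
  · intro a ha
    rw [Finset.mem_Icc] at ha
    obtain ⟨P, hP, haP⟩ := γ.blocks_cover (a := a + s) (Finset.mem_Icc.2 (by omega))
    obtain ⟨Q, hQ, rfl⟩ := hex P hP (h P hP _ haP (by omega) (by omega))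
    obtain ⟨c, hc, hca⟩ := mem_image_add.1 haP
    obtain rfl : c = a := by omega
    exact ⟨Q, (hmem Q).2 ⟨hQ, hP⟩, hc⟩
  · intro P hP Q hQ a haP haQ
    exact hinj (γ.blocks_disj ((hmem P).1 hP).2 ((hmem Q).1 hQ).2
      (Finset.mem_image_of_mem _ haP) (Finset.mem_image_of_mem _ haQ))
  · intro P hP
    rw [← γ.blocks_card ((hmem P).1 hP).2,
      Finset.card_image_of_injective _ (add_left_injective s)]
  · rintro P hP Q hQ hPQ ⟨i, j, k, l, hij, hjk, hkl, hi, hk, hj, hl⟩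
    exact γ.2.1 _ ((hmem P).1 hP).2 _ ((hmem Q).1 hQ).2 (fun h => hPQ (hinj h))
      ⟨i + s, j + s, k + s, l + s, by omega, by omega, by omega, Finset.mem_image_of_mem _ hi,
        Finset.mem_image_of_mem _ hk, Finset.mem_image_of_mem _ hj, Finset.mem_image_of_mem _ hl⟩
  · rw [mem_shift]
    constructor
    · rintro ⟨Q, hQ, rfl⟩
      obtain ⟨hQ₁, hQ₂⟩ := (hmem Q).1 hQ
      refine ⟨hQ₂, fun a ha => ?_⟩
      obtain ⟨c, hc, rfl⟩ := mem_image_add.1 ha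
      have := Finset.mem_Icc.1 (hQ₁ hc)
      omega
    · rintro ⟨hP, hP'⟩
      obtain ⟨Q, hQ, rfl⟩ := hex P hP hP'
      exact ⟨Q, (hmem Q).2 ⟨hQ, hP⟩, rfl⟩

open BinaryTree in
/-- Twice the number of nodes of a tree. -/
def treeLength : BinaryTree Unit → ℕ
  | nil => 0
  | node _ l r => (treeLength l + 2) + treeLength r

theorem treeLength_eq (t : BinaryTree Unit) : treeLength t = 2 * t.numNodes := by
  induction t with
  | nil => rfl
  | node _ l r hl hr =>
    rw [treeLength, hl, hr, BinaryTree.numNodes]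
    ring

theorem treeLength_pos {t : BinaryTree Unit} (ht : t ≠ .nil) : 0 < treeLength t := by
  cases t with
  | nil => exact absurd rfl ht
  | node _ l r => rw [treeLength]; omega

open BinaryTree in
/-- The partition described by a binary tree: the left subtree is nested inside the first block and
the right subtree follows it. -/
def ofTree : (t : BinaryTree Unit) → NC2 (treeLength t)
  | nil => empty
  | node _ l r => (ofTree l).nest.oplus (ofTree r)

theorem blocks_ofTree_nil : (ofTree .nil).blocks = ∅ := rfl

theorem blocks_ofTree_node (u : Unit) (l r : BinaryTree Unit) :
    (ofTree (.node u l r)).blocks = insert {1, treeLength l + 2} (shift 1 (ofTree l).blocks) ∪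
      shift (treeLength l + 2) (ofTree r).blocks := rfl

/-- Describes the blocks of the left subtree in terms of the whole partition and the partner of `1`;
`mem_shift_right_iff` does the same on the right. This allows a tree to be recovered from its
blocks. -/
theorem mem_shift_left_iff (u : Unit) (l r : BinaryTree Unit) (P : Finset ℕ) :
    P ∈ shift 1 (ofTree l).blocks ↔ P ∈ (ofTree (.node u l r)).blocks ∧
      ∀ a ∈ P, 1 < a ∧ a < treeLength l + 2 := by
  constructor
  · intro hP
    refine ⟨?_, fun a ha => ?_⟩
    · rw [blocks_ofTree_node]
      exact Finset.mem_union_left _ (Finset.mem_insert_of_mem hP)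
    · have := (ofTree l).shift_range hP ha
      omega
  · rintro ⟨hP, hP'⟩
    obtain ⟨a, ha⟩ := nonempty_of_mem_blocks _ hP
    rw [blocks_ofTree_node] at hP
    rcases Finset.mem_union.1 hP with hP | hP
    · rcases Finset.mem_insert.1 hP with rfl | hP
      · have := hP' 1 (by simp)
        omega
      · exact hP
    · have := (ofTree r).shift_range hP ha
      have := hP' a ha
      omega

theorem mem_shift_right_iff (u : Unit) (l r : BinaryTree Unit) (P : Finset ℕ) :
    P ∈ shift (treeLength l + 2) (ofTree r).blocks ↔ P ∈ (ofTree (.node u l r)).blocks ∧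
      ∀ a ∈ P, treeLength l + 2 < a := by
  constructor
  · intro hP
    refine ⟨?_, fun a ha => ?_⟩
    · rw [blocks_ofTree_node]
      exact Finset.mem_union_right _ hP
    · have := (ofTree r).shift_range hP ha
      omega
  · rintro ⟨hP, hP'⟩
    obtain ⟨a, ha⟩ := nonempty_of_mem_blocks _ hP
    rw [blocks_ofTree_node] at hP
    rcases Finset.mem_union.1 hP with hP | hP
    · rcases Finset.mem_insert.1 hP with rfl | hP
      · have := hP' 1 (by simp)
        omega
      · have := (ofTree l).shift_range hP ha
        have := hP' a ha
        omega
    · exact hP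

theorem first_block_mem (u : Unit) (l r : BinaryTree Unit) :
    {1, treeLength l + 2} ∈ (ofTree (.node u l r)).blocks := by
  rw [blocks_ofTree_node]
  exact Finset.mem_union_left _ (Finset.mem_insert_self _ _)

/-- The partner of `1` gives the length of the left subtree, hence the blocks of both subtrees. Sets
of blocks are compared because the partitions have different types before the lengths are known to
agree. -/
theorem ofTree_injective {t t' : BinaryTree Unit} (h : (ofTree t).blocks = (ofTree t').blocks) :
    t = t' := by
  induction t generalizing t' with
  | nil =>
    cases t' with
    | nil => rfl
    | node u l r =>
      have := first_block_mem u l r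
      rw [← h, blocks_ofTree_nil] at this
      simp at this
  | node u l r ihl ihr =>
    cases t' with
    | nil =>
      have := first_block_mem u l r
      rw [h, blocks_ofTree_nil] at this
      simp at this
    | node u' l' r' =>
      have e : ({1, treeLength l + 2} : Finset ℕ) = {1, treeLength l' + 2} := by
        refine blocks_disj _ (h ▸ first_block_mem u l r) (first_block_mem u' l' r') (a := 1) ?_ ?_
          <;> simp
      have hlen : treeLength l = treeLength l' := by
        have : treeLength l + 2 ∈ ({1, treeLength l' + 2} : Finset ℕ) := by rw [← e]; simp
        simp only [Finset.mem_insert, Finset.mem_singleton] at this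
        omega
      have hl : l = l' := by
        refine ihl (shift_injective 1 (Finset.ext fun P => ?_))
        rw [mem_shift_left_iff u l r, mem_shift_left_iff u' l' r', h, hlen]
      have hr : r = r' := by
        refine ihr (shift_injective (treeLength l + 2) (Finset.ext fun P => ?_))
        rw [mem_shift_right_iff u l r, h, hlen, mem_shift_right_iff u' l' r']
      rw [hl, hr]

/-- If `{1, k}` is the block of `1`, every other block lies strictly between `1` and `k` or beyond
`k`. The restrictions to these two intervals are smaller noncrossing pair partitions and supply the
subtrees. -/
theorem exists_ofTree {n : ℕ} (γ : NC2 n) :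
    ∃ t, treeLength t = n ∧ (ofTree t).blocks = γ.blocks := by
  induction n using Nat.strong_induction_on with
  | _ n ih =>
  rcases Nat.eq_zero_or_pos n with rfl | hn
  · exact ⟨.nil, rfl, γ.blocks_eq_empty.symm⟩
  obtain ⟨P, hP, h1P⟩ := γ.blocks_cover (a := 1) (Finset.mem_Icc.2 ⟨le_rfl, hn⟩)
  obtain ⟨k, hk1, rfl⟩ : ∃ k, 1 ≠ k ∧ P = {1, k} := by
    obtain ⟨x, y, hxy, rfl⟩ := Finset.card_eq_two.1 (γ.blocks_card hP)
    simp only [Finset.mem_insert, Finset.mem_singleton] at h1P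
    rcases h1P with rfl | rfl
    · exact ⟨y, hxy, rfl⟩
    · exact ⟨x, hxy.symm, Finset.pair_comm _ _⟩
  have hkn := Finset.mem_Icc.1 (γ.blocks_subset hP (show k ∈ _ by simp))
  have hsep : ∀ Q ∈ γ.blocks, ∀ a ∈ Q, a ≠ 1 → a ≠ k →
      Q ≠ {1, k} ∧ ∀ c ∈ Q, 1 < c ∧ (c < k ↔ a < k) ∧ c ≠ k := by
    intro Q hQ a ha ha1 hak
    have hne : Q ≠ {1, k} := by
      rintro rfl
      simp only [Finset.mem_insert, Finset.mem_singleton] at ha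
      omega
    have hout : ∀ c ∈ Q, 1 < c ∧ c ≠ k := by
      intro c hc
      have h0 := Finset.mem_Icc.1 (γ.blocks_subset hQ hc)
      have h1 : c ≠ 1 := fun h => hne (γ.blocks_disj hQ hP hc (by simp [h]))
      have h2 : c ≠ k := fun h => hne (γ.blocks_disj hQ hP hc (by simp [h]))
      omega
    -- A block with points on both sides of `k` would cross `{1, k}` in the pattern `1 < c < k < d`.
    have hcross : ∀ c ∈ Q, ∀ d ∈ Q, c < k → ¬ k < d := fun c hc d hd hck hkd =>
      γ.2.1 _ hP Q hQ hne.symm ⟨1, c, k, d, (hout c hc).1, hck, hkd, by simp, by simp, hc, hd⟩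
    refine ⟨hne, fun c hc => ?_⟩
    have h1 := hout c hc
    have h2 := hcross c hc a ha
    have h3 := hcross a ha c hc
    omega
  obtain ⟨γl, hγl⟩ := γ.exists_restrict 1 (k - 2) (by omega) fun Q hQ a ha h1 h2 c hc => by
    have := (hsep Q hQ a ha (by omega) (by omega)).2 c hc
    omega
  obtain ⟨γr, hγr⟩ := γ.exists_restrict k (n - k) (by omega) fun Q hQ a ha h1 h2 c hc => by
    have := (hsep Q hQ a ha (by omega) (by omega)).2 c hc
    have := Finset.mem_Icc.1 (γ.blocks_subset hQ hc)
    omega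
  obtain ⟨l, hl, hl'⟩ := ih (k - 2) (by omega) γl
  obtain ⟨r, hr, hr'⟩ := ih (n - k) (by omega) γr
  refine ⟨.node () l r, by rw [treeLength]; omega, ?_⟩
  rw [blocks_ofTree_node, hl', hr', show treeLength l + 2 = k by omega]
  ext Q
  rw [Finset.mem_union, Finset.mem_insert, hγl, hγr]
  constructor
  · rintro ((rfl | h) | h)
    · exact hP
    · exact h.1
    · exact h.1
  · intro hQ
    by_cases hQP : Q = {1, k}
    · exact Or.inl (Or.inl hQP)
    obtain ⟨a, ha⟩ := γ.nonempty_of_mem_blocks hQ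
    have ha1 : a ≠ 1 := fun h => hQP (γ.blocks_disj hQ hP ha (by simp [h]))
    have hak : a ≠ k := fun h => hQP (γ.blocks_disj hQ hP ha (by simp [h]))
    have h := (hsep Q hQ a ha ha1 hak).2
    rcases lt_or_gt_of_ne hak with hlt | hgt
    · refine Or.inl (Or.inr ⟨hQ, fun c hc => ?_⟩)
      have := h c hc
      omega
    · refine Or.inr ⟨hQ, fun c hc => ?_⟩
      have := h c hc
      have := Finset.mem_Icc.1 (γ.blocks_subset hQ hc)
      omega

/-- The binary tree describing a non-crossing pair partition. -/
def toTree {n : ℕ} (γ : NC2 n) : BinaryTree Unit := γ.exists_ofTree.choose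

theorem treeLength_toTree {n : ℕ} (γ : NC2 n) : treeLength γ.toTree = n :=
  γ.exists_ofTree.choose_spec.1

theorem blocks_ofTree_toTree {n : ℕ} (γ : NC2 n) : (ofTree γ.toTree).blocks = γ.blocks :=
  γ.exists_ofTree.choose_spec.2

theorem toTree_eq {n : ℕ} {γ : NC2 n} {t : BinaryTree Unit}
    (h : (ofTree t).blocks = γ.blocks) : γ.toTree = t :=
  ofTree_injective (γ.blocks_ofTree_toTree.trans h.symm)

theorem toTree_injective {n : ℕ} : Function.Injective (toTree (n := n)) := fun γ γ' h =>
  blocks_injective (by rw [← γ.blocks_ofTree_toTree, h, γ'.blocks_ofTree_toTree])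

theorem numNodes_toTree {n : ℕ} (γ : NC2 n) : γ.toTree.numNodes = γ.numBlocks := by
  have h₁ := treeLength_eq γ.toTree
  rw [treeLength_toTree] at h₁
  have h₂ := γ.two_mul_numBlocks
  omega

theorem toTree_ne_nil {n : ℕ} (hn : 0 < n) (γ : NC2 n) : γ.toTree ≠ .nil := by
  intro h
  have := γ.treeLength_toTree
  rw [h, treeLength] at this
  omega

open BinaryTree in
/-- The tree of the juxtaposition of two partitions. -/
def treeAppend : BinaryTree Unit → BinaryTree Unit → BinaryTree Unit
  | nil, t => t
  | node u l r, t => node u l (treeAppend r t)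

theorem blocks_ofTree_treeAppend (t t' : BinaryTree Unit) :
    (ofTree (treeAppend t t')).blocks =
      (ofTree t).blocks ∪ shift (treeLength t) (ofTree t').blocks := by
  induction t with
  | nil => rw [treeAppend, blocks_ofTree_nil, treeLength, shift_zero, Finset.empty_union]
  | node u l r _ ih =>
    rw [treeAppend, blocks_ofTree_node, ih, blocks_ofTree_node, shift_union, shift_shift,
      treeLength, Finset.union_assoc, add_comm (treeLength r)]

theorem toTree_pair : pair.toTree = .node () .nil .nil := toTree_eq rfl

theorem toTree_nest {n : ℕ} (γ : NC2 n) : γ.nest.toTree = .node () γ.toTree .nil := by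
  refine toTree_eq ?_
  rw [blocks_ofTree_node, blocks_ofTree_toTree, treeLength_toTree, blocks_nest, blocks_ofTree_nil,
    shift_empty, Finset.union_empty]

theorem toTree_oplus {n m : ℕ} (γ₁ : NC2 n) (γ₂ : NC2 m) :
    (γ₁.oplus γ₂).toTree = treeAppend γ₁.toTree γ₂.toTree := by
  refine toTree_eq ?_
  rw [blocks_ofTree_treeAppend, blocks_ofTree_toTree, blocks_ofTree_toTree, treeLength_toTree,
    blocks_oplus]

theorem sum_toTree_of_even {M : Type*} [AddCommMonoid M] (f : BinaryTree Unit → M) (k : ℕ) :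
    ∑ γ : NC2 (2 * k), f γ.toTree = ∑ t ∈ BinaryTree.treesOfNumNodesEq k, f t := by
  refine Finset.sum_bij (fun γ _ => γ.toTree) (fun γ _ => ?_) (fun _ _ _ _ h => toTree_injective h)
    (fun t ht => ?_) (fun _ _ => rfl)
  · rw [BinaryTree.mem_treesOfNumNodesEq, numNodes_toTree]
    have := γ.two_mul_numBlocks
    omega
  · rw [BinaryTree.mem_treesOfNumNodesEq] at ht
    subst ht
    obtain ⟨γ, hγ⟩ : ∃ γ : NC2 (2 * t.numNodes), (ofTree t).blocks = γ.blocks := by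
      rw [← treeLength_eq]
      exact ⟨_, rfl⟩
    exact ⟨γ, Finset.mem_univ _, toTree_eq hγ⟩

theorem isEmpty_of_odd {n : ℕ} (hn : Odd n) : IsEmpty (NC2 n) :=
  ⟨fun γ => by
    have := γ.two_mul_numBlocks
    grind⟩

end NC2

/-! ### The weights -/

section weights

open NC2 BinaryTree

variable {R : Type*} [Ring R] [Algebra ℂ R]

/-- The weight `V(γ, b) b` in terms of the tree of `γ`. -/
def treeMoment (η : R →ₗ[ℂ] R) (b : R) : BinaryTree Unit → R
  | nil => 1
  | node _ l r => ((l.numNodes : ℂ) + 1)⁻¹ • (η (b * treeMoment η b l) * b * treeMoment η b r)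

/-- The weight `V(γ, b)` in terms of the tree of `γ`. -/
def treeWeight (η : R →ₗ[ℂ] R) (b : R) : BinaryTree Unit → R
  | nil => 0
  | node _ l nil => ((l.numNodes : ℂ) + 1)⁻¹ • η (b * treeMoment η b l)
  | node _ l (node u l' r') =>
    ((l.numNodes : ℂ) + 1)⁻¹ • η (b * treeMoment η b l) * b * treeWeight η b (node u l' r')

theorem treeWeight_node_of_ne (η : R →ₗ[ℂ] R) (b : R) (u : Unit) (l : BinaryTree Unit)
    {r : BinaryTree Unit} (hr : r ≠ nil) :
    treeWeight η b (node u l r) =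
      ((l.numNodes : ℂ) + 1)⁻¹ • η (b * treeMoment η b l) * b * treeWeight η b r := by
  cases r with
  | nil => exact absurd rfl hr
  | node _ _ _ => rw [treeWeight]

/-- The products `V(γ, b) b` obey a uniform recursion with value `1` at the empty tree. Since `b`
need not be invertible, `V` cannot be recovered from them and is defined separately; its value at
`nil` is a placeholder. -/
theorem treeWeight_mul (η : R →ₗ[ℂ] R) (b : R) {t : BinaryTree Unit} (ht : t ≠ nil) :
    treeWeight η b t * b = treeMoment η b t := by
  induction t with
  | nil => exact absurd rfl ht
  | node u l r _ ih =>
    by_cases hr : r = nil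
    · subst hr
      rw [treeWeight, treeMoment, treeMoment, mul_one, smul_mul_assoc]
    · rw [treeWeight_node_of_ne η b u l hr, mul_assoc, ih hr, treeMoment, smul_mul_assoc,
        smul_mul_assoc]

theorem treeWeight_treeAppend (η : R →ₗ[ℂ] R) (b : R) {t t' : BinaryTree Unit} (ht : t ≠ nil)
    (ht' : t' ≠ nil) :
    treeWeight η b (treeAppend t t') = treeWeight η b t * b * treeWeight η b t' := by
  induction t with
  | nil => exact absurd rfl ht
  | node u l r _ ih =>
    by_cases hr : r = nil
    · subst hr
      rw [treeAppend, treeAppend, treeWeight_node_of_ne η b u l ht', treeWeight]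
    · have hne : treeAppend r t' ≠ nil := by
        cases r with
        | nil => exact absurd rfl hr
        | node _ _ _ => simp [treeAppend]
      rw [treeAppend, treeWeight_node_of_ne η b u l hne, ih hr, treeWeight_node_of_ne η b u l hr]
      simp only [mul_assoc]

/-- The weights `V(γ, b)`. -/
def arcsineWeight (η : R →ₗ[ℂ] R) (n : ℕ) (γ : NC2 n) (b : R) : R := treeWeight η b γ.toTree

theorem isArcsineWeight_arcsineWeight (η : R →ₗ[ℂ] R) : IsArcsineWeight η (arcsineWeight η) where
  pair b := by
    rw [arcsineWeight, toTree_pair, treeWeight, treeMoment]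
    simp
  oplus n m γ₁ γ₂ b hn hm := by
    rw [arcsineWeight, toTree_oplus,
      treeWeight_treeAppend η b (γ₁.toTree_ne_nil hn) (γ₂.toTree_ne_nil hm)]
    rfl
  nest n γ b hn := by
    rw [arcsineWeight, toTree_nest, treeWeight, numNodes_toTree, one_div,
      ← treeWeight_mul η b (γ.toTree_ne_nil hn), mul_assoc]
    rfl

/-- Uniqueness of the weights: a nonempty tree is built by nesting its left subtree and juxtaposing
its right one, so the recurrences determine every value. -/
theorem IsArcsineWeight.apply_ofTree {η : R →ₗ[ℂ] R} {V : ∀ n : ℕ, NC2 n → R → R}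
    (hV : IsArcsineWeight η V) (b : R) {t : BinaryTree Unit} (ht : t ≠ nil) :
    V (treeLength t) (ofTree t) b = treeWeight η b t := by
  induction t with
  | nil => exact absurd rfl ht
  | node u l r ihl ihr =>
    have hnest : V (treeLength l + 2) (ofTree l).nest b =
        ((l.numNodes : ℂ) + 1)⁻¹ • η (b * treeMoment η b l) := by
      by_cases hl : l = nil
      · subst hl
        -- The nesting recurrence excludes the empty partition; nesting it gives the single pair,
        -- where the first recurrence applies.
        have e : (ofTree nil).nest = NC2.pair := blocks_injective rfl
        exact (congrArg (fun γ => V 2 γ b) e).trans ((hV.pair b).trans (by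
          simp [treeMoment, numNodes]))
      · rw [hV.nest _ _ _ (treeLength_pos hl), ihl hl, mul_assoc, treeWeight_mul η b hl, one_div]
        have h₁ := (ofTree l).two_mul_numBlocks
        have h₂ := treeLength_eq l
        rw [show (ofTree l).numBlocks = l.numNodes by omega]
    by_cases hr : r = nil
    · subst hr
      -- Juxtaposition with the empty partition changes nothing. Both sides have the same type
      -- because `treeLength l + 2 + 0` reduces to `treeLength l + 2`.
      have e : (ofTree l).nest.oplus (ofTree nil) = (ofTree l).nest :=
        blocks_injective (Finset.union_empty _)
      exact (congrArg (fun γ => V (treeLength l + 2) γ b) e).trans (hnest.trans (by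
        rw [treeWeight]))
    · rw [treeWeight_node_of_ne η b u l hr, ← ihr hr, ← hnest]
      exact hV.oplus _ _ _ _ b (by omega) (treeLength_pos hr)

theorem IsArcsineWeight.eq_arcsineWeight {η : R →ₗ[ℂ] R} {V : ∀ n : ℕ, NC2 n → R → R}
    (hV : IsArcsineWeight η V) {n : ℕ} (hn : 0 < n) : V n = arcsineWeight η n := by
  funext γ b
  obtain ⟨t, rfl, h⟩ := γ.exists_ofTree
  obtain rfl := blocks_injective h
  have ht : t ≠ nil := by
    rintro rfl
    simp [treeLength] at hn
  rw [hV.apply_ofTree b ht, arcsineWeight, toTree_eq rfl]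

theorem sum_treeMoment_succ (η : R →ₗ[ℂ] R) (b : R) (k : ℕ) :
    ∑ t ∈ treesOfNumNodesEq (k + 1), treeMoment η b t =
      ∑ ij ∈ Finset.HasAntidiagonal.antidiagonal k, ((ij.1 : ℂ) + 1)⁻¹ •
        (η (b * ∑ t ∈ treesOfNumNodesEq ij.1, treeMoment η b t) * b *
          ∑ t ∈ treesOfNumNodesEq ij.2, treeMoment η b t) := by
  rw [treesOfNumNodesEq_succ, Finset.sum_biUnion]
  · refine Finset.sum_congr rfl fun ij _ => ?_
    rw [Finset.sum_map, Finset.sum_product, Finset.mul_sum (treesOfNumNodesEq ij.1), map_sum,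
      Finset.sum_mul, Finset.sum_mul, Finset.smul_sum]
    refine Finset.sum_congr rfl fun l hl => ?_
    rw [Finset.mul_sum, Finset.smul_sum]
    refine Finset.sum_congr rfl fun r _ => ?_
    rw [← mem_treesOfNumNodesEq.1 hl]
    rfl
  · intro ij _ ij' _ hne
    refine Finset.disjoint_left.2 fun t ht ht' => hne ?_
    obtain ⟨⟨l, r⟩, h, rfl⟩ := Finset.mem_map.1 ht
    obtain ⟨⟨l', r'⟩, h', e⟩ := Finset.mem_map.1 ht'
    obtain ⟨-, rfl, rfl⟩ := node.inj e
    simp only [Finset.mem_product, mem_treesOfNumNodesEq] at h h'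
    exact Prod.ext (h.1.symm.trans h'.1) (h.2.symm.trans h'.2)

/-- Both sides satisfy the same Catalan-type recursion, by `sum_treeMoment_succ` and
`contractMoment_replicate_succ`. -/
theorem sum_treeMoment (η : R →ₗ[ℂ] R) (b : R) (k : ℕ) :
    ∑ t ∈ treesOfNumNodesEq k, treeMoment η b t =
      contractMoment η k (List.replicate (2 * k) b) := by
  induction k using Nat.strong_induction_on with
  | _ k ih =>
  cases k with
  | zero =>
    rw [treesOfNumNodesEq_zero, Finset.sum_singleton]
    rfl
  | succ k =>
    rw [sum_treeMoment_succ, contractMoment_replicate_succ]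
    refine Finset.sum_congr rfl fun ij hij => ?_
    have := Finset.HasAntidiagonal.mem_antidiagonal.1 hij
    rw [ih ij.1 (by omega), ih ij.2 (by omega)]

theorem entrywise_arcsine_matMono_replicate {B : Type*} [Ring B] [Algebra ℂ B] {m : ℕ}
    (η : B →ₗ[ℂ] B) (b : Matrix (Fin m) (Fin m) B) {n : ℕ} (hn : 0 < n) :
    entrywise (NCPoly.arcsine η) (matMono (List.replicate n b)) =
      ∑ γ : NC2 n, arcsineWeight η.mapMatrix n γ b * b := by
  have h : ∀ γ : NC2 n, arcsineWeight η.mapMatrix n γ b * b = treeMoment η.mapMatrix b γ.toTree :=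
    fun γ => treeWeight_mul _ b (γ.toTree_ne_nil hn)
  simp only [h]
  rcases Nat.even_or_odd n with he | ho
  · obtain ⟨k, rfl⟩ := even_iff_exists_two_mul.1 he
    rw [sum_toTree_of_even, sum_treeMoment,
      entrywise_arcsine_matMono_of_even η List.length_replicate]
  · have := isEmpty_of_odd ho
    rw [entrywise_arcsine_matMono_of_odd η (by simpa using ho), Finset.univ_eq_empty,
      Finset.sum_empty]

end weights

end

theorem mainTheorem2 {B : Type*} [CStarAlgebra B] [PartialOrder B] [StarOrderedRing B] :
    ∃ 𝔞 : (B →ₗ[ℂ] B) → (NCPoly B →ₗ[ℂ] B),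
      ∀ (A : Type*) [CStarAlgebra A] (ι : B →⋆ₐ[ℂ] A) (E : A →ₗ[ℂ] B) (X : ℕ → A)
        (η : B →ₗ[ℂ] B),
        Function.Injective ι → IsPosCondExp ι E →
        (∀ i, IsSelfAdjoint (X i)) →
        (∀ i, E (X i) = 0) →
        (∀ i j, distribution ι E (X i) = distribution ι E (X j)) →
        MonotoneIndependent ι E X →
        (∀ i b, η b = E (X i * ι b * X i)) →
        -- the limit law is a positive conditional expectation
        IsPosCondExp (NCPoly.C B) (𝔞 η) ∧
        -- weak convergence
        (∀ p : NCPoly B, Tendsto (fun N : ℕ => distribution ι E (normalizedSum X N) p) atTop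
          (𝓝 (𝔞 η p))) ∧
        -- the moments of the fully matricial extension
        (∀ m : ℕ, ∃ V : ∀ n : ℕ, NC2 n → Matrix (Fin m) (Fin m) B → Matrix (Fin m) (Fin m) B,
          IsArcsineWeight η.mapMatrix V ∧
          (∀ V', IsArcsineWeight η.mapMatrix V' → ∀ n, 0 < n → V' n = V n) ∧
          ∀ (n : ℕ) (b : Matrix (Fin m) (Fin m) B), 0 < n →
            (𝔞 η).mapMatrix (matX b ^ n) = ∑ γ : NC2 n, V n γ b * b) := by
  -- The witness is a function of `η` fixed before `A`, `E` and the variables, which expresses that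
  -- the limit depends on `η` alone.
  refine ⟨NCPoly.arcsine, fun A _ ι E X η _ hE hsa h₀ hid hX hη => ?_⟩
  have hlim := tendsto_distribution_normalizedSum hE hX h₀ hid hη
  refine ⟨isPosCondExp_of_tendsto
    (fun N => isPosCondExp_distribution hE (isSelfAdjoint_normalizedSum hsa N)) hlim, hlim,
    fun m => ⟨arcsineWeight η.mapMatrix, isArcsineWeight_arcsineWeight _,
      fun V' hV' n hn => hV'.eq_arcsineWeight hn, fun n b hn => ?_⟩⟩
  rw [matX_pow]
  exact entrywise_arcsine_matMono_replicate η b hn
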